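/- **Theorem (estimate of the velocity error $e_u$).** Let $d\in\{2,3\}$, let $\Omega\subset\mathbb R^d$ be open and bounded, let $T>0$ and let $r\ge 1$ be an integer. Write $\langle\cdot,\cdot\rangle$, $\|\cdot\|$ for the inner product and norm of $L^2(\Omega)$ (scalar, vector and matrix valued), $\|\cdot\|_m$ for the norm of $H^m(\Omega)$, $V=H^1_0(\Omega)^d$, where $H^1_0(\Omega)$ is the closure of $C_c^\infty(\Omega)$ in $H^1(\Omega)$, $Q=\{q\in L^2(\Omega):\int_\Omega q\,dx=0\}$, $a(u,v)=\langle\nabla u,\nabla v\rangle$ and $b(v,q)=-\langle\nabla\cdot v,q\rangle$. *Continuous problem.* Let $f\in C([0,T];L^2(\Omega)^d)$ and let $(u,p)$ be a solution of the Stokes system $$\partial_t u-\Delta u+\nabla p=f,\quad \nabla\cdot u=0\ \text{ in }\Omega\times(0,T],\qquad u(0)=u_0,$$ with $u(t)\in V$ and $p(t)\in Q$ for all $t\in[0,T]$, that is regular in the sense that $u\in C^1([0,T];H^{r+1}(\Omega)^d)\cap C^2([0,T];H^1(\Omega)^d)\cap C^3([0,T];L^2(\Omega)^d)$ and $p\in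 C^1([0,T];H^r(\Omega))$. *Discretization in space.* For $h>0$, let $V_h\subset V$ and $Q_h\subset Q$ be finite-dimensional subspaces (finite element spaces of mesh size $h$) such that, with constants $\beta>0$ and $c_A$, $$\sup_{v_h\in V_h\setminus\{0\}}\frac{b(v_h,q_h)}{\|v_h\|_1\|q_h\|}\ge\beta\quad\text{for all } q_h\in Q_h\setminus\{0\},$$ and such that for every $v\in V\cap H^{r+1}(\Omega)^d$ there is $v_h\in V_h$ with $\|v-v_h\|+h\|\nabla(v-v_h)\|\le c_Ah^{r+1}\|v\|_{r+1}$, and for every $q\in Q\cap H^r(\Omega)$ there is $q_h\in Q_h$ with $\|q-q_h\|\le c_Ah^r\|q\|_r$. Let $V_h^{\rm div}=\{v_h\in V_h: b(v_h,q_h)=0\ \ \forall q_h\in Q_h\}$. *Discretization in time.* Let $0=t_0<t_1<\dots<t_N=T$, $I_n=(t_{n-1},t_n]$, $\tau_n=t_n-t_{n-1}$, $\bar t_n=(t_{n-1}+t_n)/2$, $\tau=\max_n\tau_n$. Given $u_{0,h}\in V_h^{\rm div}$, let $u_{\tau,h}:[0,T]\to V_h$ be continuous and let $p_{\tau,h}:(0,T]\to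 Q_h$, both polynomial of degree at most one in $t$ on each $I_n$, with $u_{\tau,h}(0)=u_{0,h}$ and, for $n=1,\dots,N$ and all $v_h\in V_h$, $q_h\in Q_h$, $$\int_{t_{n-1}}^{t_n}\big(\langle\partial_tu_{\tau,h},v_h\rangle+a(u_{\tau,h},v_h)+b(v_h,p_{\tau,h})\big)\,dt=\frac{\tau_n}{2}\big(\langle f(t_{n-1}),v_h\rangle+\langle f(t_n),v_h\rangle\big),\qquad \int_{t_{n-1}}^{t_n}b(u_{\tau,h},q_h)\,dt=0 .$$ *Claim.* There is a constant $C>0$, depending only on the data and solution of the continuous problem ($\Omega,T,f,u_0,u,p$), on $r$, $\beta$ and $c_A$, but not on $h$, $V_h$, $Q_h$, the time mesh or the discrete solution, such that $e_u=u-u_{\tau,h}$ satisfies, for all $n=1,\dots,N$, $$\sum_{m=1}^n\tau_m\|\partial_te_u(\bar t_m)\|^2+\|\nabla e_u(t_n)\|^2\le C\big(\|\nabla e_u(0)\|^2+\tau^4+h^{2r}\big),$$ $$\|e_u(t_n)\|^2+\sum_{m=1}^n\tau_m\|\nabla e_u(\bar t_m)\|^2\le C\big(\|e_u(0)\|^2+\tau^4+h^{2r}\big).$$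 In particular $\partial_tu_{\tau,h}$ is superconvergent of second order in $\tau$ at the midpoints $\bar t_m$. -/

import Mathlib

open MeasureTheory Set TopologicalSpace

noncomputable section

namespace StokesCGP

/-- `ℝ^d` with the Euclidean norm. -/
abbrev Pt (d : ℕ) : Type := EuclideanSpace ℝ (Fin d)

/-! ### Function spaces in space -/

/-- `L²(Ω)`. -/
abbrev L2 {d : ℕ} (Ω : Opens (Pt d)) : Type :=
  Lp ℝ 2 ((volume : Measure (Pt d)).restrict (Ω : Set (Pt d)))

/-- `L²(Ω)^d` with the inner product `⟨u, v⟩ = ∑ i, ⟨u i, v i⟩`. -/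
abbrev VecL2 {d : ℕ} (Ω : Opens (Pt d)) : Type := PiLp 2 (fun _ : Fin d => L2 Ω)

/-- `g = ∂_i f` in the weak sense in `Ω`. -/
def HasWeakPDeriv {d : ℕ} {Ω : Opens (Pt d)} (i : Fin d) (f g : L2 Ω) : Prop :=
  ∀ φ : TestFunction Ω ℝ ⊤,
    ∫ x in (Ω : Set (Pt d)), f x * fderiv ℝ φ x (EuclideanSpace.single i 1)
      = - ∫ x in (Ω : Set (Pt d)), g x * φ x

/-- Multi-indices `α ∈ ℕ^d` of order `|α| ≤ m`. -/
abbrev MultiIndex (d m : ℕ) : Type := {α : Fin d → ℕ // ∑ i, α i ≤ m}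

instance instFintypeMultiIndex (d m : ℕ) : Fintype (MultiIndex d m) :=
  Fintype.ofInjective
    (fun (α : MultiIndex d m) (i : Fin d) =>
      (⟨α.1 i, Nat.lt_succ_of_le
        ((Finset.single_le_sum (fun _ _ => Nat.zero_le _) (Finset.mem_univ i)).trans α.2)⟩ :
        Fin (m + 1)))
    (fun α β h => Subtype.ext (funext fun i => by
      have := congrArg Fin.val (congrFun h i)
      exact this))

lemma integrable_mul_of_compactSupport {d : ℕ} {Ω : Opens (Pt d)} (f : L2 Ω) {ψ : Pt d → ℝ}
    (hψ : Continuous ψ) (hc : HasCompactSupport ψ) :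
    Integrable (fun x => f x * ψ x) (volume.restrict (Ω : Set (Pt d))) :=
  MemLp.integrable_mul (p := 2) (q := 2) (Lp.memLp f) ((hψ.memLp_of_hasCompactSupport hc).restrict _)

lemma HasWeakPDeriv.add {d : ℕ} {Ω : Opens (Pt d)} {i : Fin d} {f g f' g' : L2 Ω}
    (h : HasWeakPDeriv i f g) (h' : HasWeakPDeriv i f' g') :
    HasWeakPDeriv i (f + f') (g + g') := by
  intro φ
  have c1 : Continuous fun x => fderiv ℝ φ x (EuclideanSpace.single i 1) :=
    (φ.contDiff.continuous_fderiv (by simp)).clm_apply continuous_const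
  have c2 : HasCompactSupport fun x => fderiv ℝ φ x (EuclideanSpace.single i 1) :=
    φ.hasCompactSupport.fderiv_apply ℝ _
  have e1 : ∫ x in (Ω : Set (Pt d)), (f + f') x * fderiv ℝ φ x (EuclideanSpace.single i 1)
      = ∫ x in (Ω : Set (Pt d)), (f x * fderiv ℝ φ x (EuclideanSpace.single i 1)
        + f' x * fderiv ℝ φ x (EuclideanSpace.single i 1)) := by
    refine integral_congr_ae ?_
    filter_upwards [Lp.coeFn_add f f'] with x hx
    rw [hx, Pi.add_apply, add_mul]
  have e2 : ∫ x in (Ω : Set (Pt d)), (g + g') x * φ x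
      = ∫ x in (Ω : Set (Pt d)), (g x * φ x + g' x * φ x) := by
    refine integral_congr_ae ?_
    filter_upwards [Lp.coeFn_add g g'] with x hx
    rw [hx, Pi.add_apply, add_mul]
  rw [e1, e2, integral_add (integrable_mul_of_compactSupport f c1 c2)
      (integrable_mul_of_compactSupport f' c1 c2),
    integral_add (integrable_mul_of_compactSupport g φ.contDiff.continuous φ.hasCompactSupport)
      (integrable_mul_of_compactSupport g' φ.contDiff.continuous φ.hasCompactSupport), h φ, h' φ]
  ring

lemma HasWeakPDeriv.smul {d : ℕ} {Ω : Opens (Pt d)} {i : Fin d} {f g : L2 Ω} (c : ℝ)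
    (h : HasWeakPDeriv i f g) : HasWeakPDeriv i (c • f) (c • g) := by
  intro φ
  have e1 : ∫ x in (Ω : Set (Pt d)), (c • f) x * fderiv ℝ φ x (EuclideanSpace.single i 1)
      = ∫ x in (Ω : Set (Pt d)), c * (f x * fderiv ℝ φ x (EuclideanSpace.single i 1)) := by
    refine integral_congr_ae ?_
    filter_upwards [Lp.coeFn_smul c f] with x hx
    rw [hx, Pi.smul_apply, smul_eq_mul, mul_assoc]
  have e2 : ∫ x in (Ω : Set (Pt d)), (c • g) x * φ x
      = ∫ x in (Ω : Set (Pt d)), c * (g x * φ x) := by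
    refine integral_congr_ae ?_
    filter_upwards [Lp.coeFn_smul c g] with x hx
    rw [hx, Pi.smul_apply, smul_eq_mul, mul_assoc]
  rw [e1, e2, integral_const_mul, integral_const_mul, h φ]
  ring

lemma HasWeakPDeriv.zero {d : ℕ} {Ω : Opens (Pt d)} (i : Fin d) :
    HasWeakPDeriv i (0 : L2 Ω) 0 := by
  intro φ
  have e : ∀ ψ : Pt d → ℝ, ∫ x in (Ω : Set (Pt d)), (0 : L2 Ω) x * ψ x = 0 := by
    intro ψ
    rw [← integral_zero (Pt d) ℝ (μ := volume.restrict (Ω : Set (Pt d)))]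
    refine integral_congr_ae ?_
    filter_upwards [Lp.coeFn_zero ℝ 2 (volume.restrict (Ω : Set (Pt d)))] with x hx
    rw [hx, Pi.zero_apply, zero_mul]
  rw [e, e, neg_zero]

/-- The Sobolev space `H^m(Ω)`. A function is recorded together with its weak derivatives:
an element is a family `(w_α)_{|α| ≤ m}` in `L²(Ω)` with `w_{α + e_i} = ∂_i w_α` weakly, that is,
`w_α = D^α w_0`. The inherited norm is `‖w‖_m = (∑_{|α| ≤ m} ‖D^α w‖²)^{1/2}`. -/
def sobolev (d m : ℕ) (Ω : Opens (Pt d)) :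
    Submodule ℝ (PiLp 2 (fun _ : MultiIndex d m => L2 Ω)) where
  carrier := {w | ∀ (α β : MultiIndex d m) (i : Fin d),
    β.1 = α.1 + Pi.single i 1 → HasWeakPDeriv i (w α) (w β)}
  add_mem' := fun hv hw α β i h => (hv α β i h).add (hw α β i h)
  zero_mem' := fun _ _ i _ => HasWeakPDeriv.zero i
  smul_mem' := fun c _ hw α β i h => (hw α β i h).smul c

/-- `H^m(Ω)` as a normed space. -/
abbrev Sobolev {d : ℕ} (m : ℕ) (Ω : Opens (Pt d)) : Type := ↥(sobolev d m Ω)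

/-- `H^m(Ω)^d` as a normed space. -/
abbrev VecSobolev {d : ℕ} (m : ℕ) (Ω : Opens (Pt d)) : Type := PiLp 2 (fun _ : Fin d => Sobolev m Ω)

/-- The function in `L²(Ω)` underlying an element of `H^m(Ω)`. -/
def Sobolev.toL2 {d m : ℕ} {Ω : Opens (Pt d)} (w : Sobolev m Ω) : L2 Ω :=
  w.1 ⟨0, by simp⟩

/-- The inclusion `H^m(Ω) ⊆ H^k(Ω)`, `k ≤ m`. -/
def Sobolev.incl {d m k : ℕ} {Ω : Opens (Pt d)} (hkm : k ≤ m) (w : Sobolev m Ω) : Sobolev k Ω :=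
  ⟨WithLp.toLp 2 fun α => w.1 ⟨α.1, α.2.trans hkm⟩,
    fun α β i h => w.2 ⟨α.1, α.2.trans hkm⟩ ⟨β.1, β.2.trans hkm⟩ i h⟩

/-- The weak partial derivative `∂_j w ∈ L²(Ω)` of `w ∈ H^m(Ω)`, `m ≥ 1`. -/
def Sobolev.pderiv {d m : ℕ} {Ω : Opens (Pt d)} (hm : 1 ≤ m) (j : Fin d) (w : Sobolev m Ω) : L2 Ω :=
  w.1 ⟨Pi.single j 1, by simpa using hm⟩

/-- The weak Laplacian `Δ w = ∑ j, ∂_j ∂_j w ∈ L²(Ω)` of `w ∈ H^m(Ω)`, `m ≥ 2`. -/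
def Sobolev.laplacian {d m : ℕ} {Ω : Opens (Pt d)} (hm : 2 ≤ m) (w : Sobolev m Ω) : L2 Ω :=
  ∑ j : Fin d, w.1 ⟨Pi.single j 2, by simpa using hm⟩

/-- The function in `L²(Ω)^d` underlying an element of `H^m(Ω)^d`. -/
def VecSobolev.toL2 {d m : ℕ} {Ω : Opens (Pt d)} (v : VecSobolev m Ω) : VecL2 Ω :=
  WithLp.toLp 2 fun i => (v i).toL2

/-- The inclusion `H^m(Ω)^d ⊆ H^k(Ω)^d`, `k ≤ m`. -/
def VecSobolev.incl {d m k : ℕ} {Ω : Opens (Pt d)} (hkm : k ≤ m) (v : VecSobolev m Ω) :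
    VecSobolev k Ω :=
  WithLp.toLp 2 fun i => (v i).incl hkm

/-- `H^1_0(Ω)`: the closure in `H^1(Ω)` of the test functions `C_c^∞(Ω)`. -/
def H10 {d : ℕ} (Ω : Opens (Pt d)) : Submodule ℝ (Sobolev 1 Ω) :=
  (Submodule.span ℝ {w : Sobolev 1 Ω | ∃ φ : TestFunction Ω ℝ ⊤,
    (w.toL2 : Pt d → ℝ) =ᵐ[volume.restrict (Ω : Set (Pt d))] φ}).topologicalClosure

/-- The velocity space `V = H^1_0(Ω)^d`. -/
def velocitySpace {d : ℕ} (Ω : Opens (Pt d)) : Submodule ℝ (VecSobolev 1 Ω) where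
  carrier := {v | ∀ i, v i ∈ H10 Ω}
  add_mem' := fun hv hw i => (H10 Ω).add_mem (hv i) (hw i)
  zero_mem' := fun _ => (H10 Ω).zero_mem
  smul_mem' := fun c _ hv i => (H10 Ω).smul_mem c (hv i)

/-- The pressure space `Q = L²_0(Ω)` (for bounded `Ω`). -/
def pressureSpace {d : ℕ} (Ω : Opens (Pt d)) : Set (L2 Ω) :=
  {q | ∫ x in (Ω : Set (Pt d)), q x = 0}

/-- The divergence `∇ · v ∈ L²(Ω)` of `v ∈ H^m(Ω)^d`, `m ≥ 1`. -/
def divergence {d m : ℕ} {Ω : Opens (Pt d)} (hm : 1 ≤ m) (v : VecSobolev m Ω) : L2 Ω :=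
  ∑ i : Fin d, (v i).pderiv hm i

/-- `a(u, v) = ⟨∇u, ∇v⟩`. -/
def aForm {d : ℕ} {Ω : Opens (Pt d)} (u v : VecSobolev 1 Ω) : ℝ :=
  ∑ i : Fin d, ∑ j : Fin d, inner ℝ ((u i).pderiv le_rfl j) ((v i).pderiv le_rfl j)

/-- `b(v, q) = - ⟨∇ · v, q⟩`. -/
def bForm {d : ℕ} {Ω : Opens (Pt d)} (v : VecSobolev 1 Ω) (q : L2 Ω) : ℝ :=
  - inner ℝ (divergence le_rfl v) q

/-- `‖∇v‖` (the `L²(Ω)`-norm of the gradient). -/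
def gradNorm {d : ℕ} {Ω : Opens (Pt d)} (v : VecSobolev 1 Ω) : ℝ := Real.sqrt (aForm v v)

/-! ### The Stokes system -/

/-- `(u, p)` is a sufficiently regular solution on `[0,T]` of the Stokes system
`∂_t u - Δu + ∇p = f`, `∇ · u = 0` in `Ω × (0,T]`, `u(0) = u₀`, `u = 0` on `∂Ω × [0,T]`,
with `p(t)` of mean value zero. The regularity is: `u ∈ C¹([0,T]; H^{r+1})`, `u ∈ C²([0,T]; H¹)`,
`u ∈ C³([0,T]; L²)`, `p ∈ C¹([0,T]; H^r)`, `f ∈ C([0,T]; L²)`. -/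
structure IsRegularStokesSolution {d : ℕ} (Ω : Opens (Pt d)) (T : ℝ) (r : ℕ) (hr : 1 ≤ r)
    (f : ℝ → VecL2 Ω) (u₀ : VecL2 Ω) (u : ℝ → VecSobolev (r + 1) Ω) (p : ℝ → Sobolev r Ω) :
    Prop where
  f_cont : ContinuousOn f (Icc 0 T)
  u_reg : ContDiffOn ℝ 1 u (Icc 0 T)
  u_reg_H1 : ContDiffOn ℝ 2 (fun t => (u t).incl (Nat.le_add_left 1 r)) (Icc 0 T)
  u_reg_L2 : ContDiffOn ℝ 3 (fun t => (u t).toL2) (Icc 0 T)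
  p_reg : ContDiffOn ℝ 1 p (Icc 0 T)
  momentum : ∀ t ∈ Ioc 0 T, ∀ i : Fin d,
    (derivWithin (fun s => (u s).toL2) (Icc 0 T) t) i
      - (u t i).laplacian (Nat.add_le_add_right hr 1) + (p t).pderiv hr i = f t i
  div_free : ∀ t ∈ Ioc 0 T, divergence (Nat.le_add_left 1 r) (u t) = 0
  initial : (u 0).toL2 = u₀
  boundary : ∀ t ∈ Icc 0 T, (u t).incl (Nat.le_add_left 1 r) ∈ velocitySpace Ω
  mean_zero : ∀ t ∈ Icc 0 T, (p t).toL2 ∈ pressureSpace Ω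

/-! ### Discretization in space -/

/-- Finite element spaces `V_h ⊆ V`, `Q_h ⊆ Q` of mesh size `h > 0` that are inf-sup stable with
constant `β` and have approximation order `r` with constant `cA`. -/
structure IsFEPair {d : ℕ} (Ω : Opens (Pt d)) (r : ℕ) (β cA h : ℝ)
    (Vh : Submodule ℝ (VecSobolev 1 Ω)) (Qh : Submodule ℝ (L2 Ω)) : Prop where
  h_pos : 0 < h
  finite_V : FiniteDimensional ℝ Vh
  finite_Q : FiniteDimensional ℝ Qh
  sub_V : Vh ≤ velocitySpace Ω
  sub_Q : (Qh : Set (L2 Ω)) ⊆ pressureSpace Ω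
  inf_sup : ∀ q ∈ Qh, q ≠ 0 →
    β ≤ ⨆ v : {v : VecSobolev 1 Ω // v ∈ Vh ∧ v ≠ 0}, bForm v.1 q / (‖v.1‖ * ‖q‖)
  approx_V : ∀ v : VecSobolev (r + 1) Ω, v.incl (Nat.le_add_left 1 r) ∈ velocitySpace Ω →
    ∃ vh ∈ Vh, ‖v.toL2 - vh.toL2‖ + h * gradNorm (v.incl (Nat.le_add_left 1 r) - vh)
      ≤ cA * h ^ (r + 1) * ‖v‖
  approx_Q : ∀ q : Sobolev r Ω, q.toL2 ∈ pressureSpace Ω →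
    ∃ qh ∈ Qh, ‖q.toL2 - qh‖ ≤ cA * h ^ r * ‖q‖

/-- The discretely divergence-free functions `V_h^div`. -/
def discreteDivFree {d : ℕ} {Ω : Opens (Pt d)} (Vh : Submodule ℝ (VecSobolev 1 Ω))
    (Qh : Submodule ℝ (L2 Ω)) : Set (VecSobolev 1 Ω) :=
  {v | v ∈ Vh ∧ ∀ q ∈ Qh, bForm v q = 0}

/-! ### Discretization in time -/

/-- A decomposition `0 = t_0 < t_1 < ⋯ < t_N = T` (only `t n` with `n ≤ N` matter). -/
structure TimeMesh (T : ℝ) where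
  N : ℕ
  t : ℕ → ℝ
  t_zero : t 0 = 0
  t_last : t N = T
  t_lt : ∀ n < N, t n < t (n + 1)

namespace TimeMesh

variable {T : ℝ} (M : TimeMesh T)

/-- `τ_n = t_n - t_{n-1}` for `n = 1, …, N`. -/
def len (n : ℕ) : ℝ := M.t n - M.t (n - 1)

/-- The midpoint of `I_n`, `n = 1, …, N`. -/
def mid (n : ℕ) : ℝ := (M.t (n - 1) + M.t n) / 2

/-- The interval `I_n = (t_{n-1}, t_n]`, `n = 1, …, N`. -/
def intv (n : ℕ) : Set ℝ := Ioc (M.t (n - 1)) (M.t n)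

/-- `τ = max_{1 ≤ n ≤ N} τ_n`. -/
def size : ℝ := ⨆ n : Fin M.N, M.len (n + 1)

/-- The 2-point Gauss--Lobatto (trapezoidal) formula on `I_n`, with one-sided limits from the
interior of `I_n`. -/
def quadGL (n : ℕ) (g : ℝ → ℝ) : ℝ :=
  M.len n / 2 * (Function.rightLim g (M.t (n - 1)) + Function.leftLim g (M.t n))

end TimeMesh

/-- `w ∈ P_k(J; B)` for a subspace `B`: `w(t) = ∑_{j ≤ k} t^j W_j` on `J` with `W_j ∈ B`. -/
def IsPolyOn {X : Type*} [AddCommGroup X] [Module ℝ X] (k : ℕ) (J : Set ℝ) (B : Submodule ℝ X)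
    (w : ℝ → X) : Prop :=
  ∃ W : ℕ → X, (∀ j, W j ∈ B) ∧ ∀ t ∈ J, w t = ∑ j ∈ Finset.range (k + 1), t ^ j • W j

/-- `(u_{τ,h}, p_{τ,h}) ∈ X^1_τ(V_h) × Y^1_τ(Q_h)` solves, for `n = 1, …, N`, the local space-time
problems on `I_n`, starting from the discrete initial value `u_{0,h} ∈ V_h^div`. -/
structure IsDiscreteSolution {d : ℕ} {Ω : Opens (Pt d)} {T : ℝ} (f : ℝ → VecL2 Ω)
    (Vh : Submodule ℝ (VecSobolev 1 Ω)) (Qh : Submodule ℝ (L2 Ω)) (M : TimeMesh T)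
    (u₀h : VecSobolev 1 Ω) (uh : ℝ → VecSobolev 1 Ω) (ph : ℝ → L2 Ω) : Prop where
  u_cont : ContinuousOn uh (Icc 0 T)
  u_poly : ∀ n ∈ Finset.Icc 1 M.N, IsPolyOn 1 (M.intv n) Vh uh
  p_poly : ∀ n ∈ Finset.Icc 1 M.N, IsPolyOn 1 (M.intv n) Qh ph
  initial_mem : u₀h ∈ discreteDivFree Vh Qh
  initial : uh 0 = u₀h
  momentum : ∀ n ∈ Finset.Icc 1 M.N, ∀ v : ℝ → VecSobolev 1 Ω, IsPolyOn 0 (M.intv n) Vh v →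
    ∫ s in (M.t (n - 1))..(M.t n),
        (inner ℝ (deriv (fun s' => (uh s').toL2) s) (v s).toL2
          + aForm (uh s) (v s) + bForm (v s) (ph s))
      = M.quadGL n (fun s => inner ℝ (f s) (v s).toL2)
  div_free : ∀ n ∈ Finset.Icc 1 M.N, ∀ q : ℝ → L2 Ω, IsPolyOn 0 (M.intv n) Qh q →
    ∫ s in (M.t (n - 1))..(M.t n), bForm (uh s) (q s) = 0

/-- The velocity error `e_u = u - u_{τ,h}`. -/
def velocityError {d r : ℕ} {Ω : Opens (Pt d)} (u : ℝ → VecSobolev (r + 1) Ω)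
    (uh : ℝ → VecSobolev 1 Ω) (t : ℝ) : VecSobolev 1 Ω :=
  (u t).incl (Nat.le_add_left 1 r) - uh t

end StokesCGP

end

/-! Tested with discretely divergence-free functions, the scheme loses its pressure. Since
$u_{\tau,h}$ is affine on each $I_m$, what remains is the Crank-Nicolson scheme for the nodal values
(`IsDiscreteSolution.crankNicolson`), and these stay in $V_h^{\rm div}$
(`IsDiscreteSolution.mem_discreteDivFree`).

The comparison function is the Stokes projection $\theta(t)\in V_h^{\rm div}$, with
$\langle\nabla\theta,\nabla w\rangle=\langle\nabla u,\nabla w\rangle+b(w,p)$ for $w\in V_h^{\rm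
div}$. Including $p$ removes the continuous pressure from the error equation. A Céa argument gives
$\|\nabla(u-\theta)\|=O(h^r)$; the inf-sup condition supplies good approximants inside $V_h^{\rm
div}$. By linearity the increments of $u-\theta$ over $[a,b]$ are $O(h^r(b-a))$
(`IsFEPair.exists_isStokesProjection`).

The difference $\xi_m=\theta(t_m)-u_{\tau,h}(t_m)$ solves a Crank-Nicolson scheme whose residual is
$\tau_m\,O(h^r+\tau^2)$: an increment of $u-\theta$ plus a trapezoidal error of $\partial_tu$
(`IsDiscreteSolution.error_equation`, `IsStokesProjection.norm_residual_le`). Testing with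
$\xi_m-\xi_{m-1}$ makes $\|\nabla\xi\|^2$ telescope; testing with $(\xi_{m-1}+\xi_m)/2$ makes
$\|\xi\|^2$ telescope. Young's inequality absorbs the residual, so no Gronwall argument is needed.

The triangle inequality then returns to $e_u$. Second order at the midpoints holds because
$\partial_tu_{\tau,h}(\bar t_m)$ is a difference quotient, which for $u$ itself matches
$\partial_tu(\bar t_m)$ up to $O(\tau_m^2)$. The $L^2$ bound also has $h^{2r}$ because it is drawn
from the gradient bound by Poincaré, without a duality argument. -/

noncomputable section

namespace StokesCGP

/-! ### Midpoint and trapezoidal errors for vector-valued functions of time. -/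

section TimeQuadrature

variable {E : Type*} [NormedAddCommGroup E] [NormedSpace ℝ E]

lemma exists_lipschitz_of_contDiffOn_Icc {T : ℝ} (hT : 0 < T) {f : ℝ → E}
    (hf : ContDiffOn ℝ 1 f (Icc 0 T)) :
    ∃ L, 0 ≤ L ∧ ∀ x ∈ Icc 0 T, ∀ y ∈ Icc 0 T, ‖f x - f y‖ ≤ L * |x - y| := by
  have hc : ContinuousOn (derivWithin f (Icc 0 T)) (Icc 0 T) :=
    hf.continuousOn_derivWithin (uniqueDiffOn_Icc hT) le_rfl
  obtain ⟨L, hL⟩ := isCompact_Icc.exists_bound_of_continuousOn hc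
  refine ⟨L, (norm_nonneg _).trans (hL 0 ⟨le_rfl, hT.le⟩), fun x hx y hy => ?_⟩
  have := (convex_Icc 0 T).norm_image_sub_le_of_norm_hasDerivWithin_le
    (fun z hz => (hf.differentiableOn (by simp) z hz).hasDerivWithinAt) hL hy hx
  simpa [Real.norm_eq_abs] using this

variable {s : Set ℝ} {f f₁ f₂ : ℝ → E} {L : ℝ}

/-- Mean value inequality for $w\mapsto f(w)-w f_1(z)$, whose derivative is at most $L(b-a)$. The
point $z$ is free, so expansions about the midpoint and about an endpoint are both covered. -/
lemma norm_sub_sub_smul_deriv_le (hs : Convex ℝ s)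
    (hf : ∀ x ∈ s, HasDerivWithinAt f (f₁ x) s x)
    (hL : ∀ x ∈ s, ∀ y ∈ s, ‖f₁ x - f₁ y‖ ≤ L * |x - y|) (hL0 : 0 ≤ L) {a b x y z : ℝ}
    (ha : a ∈ s) (hb : b ∈ s) (hx : x ∈ Icc a b) (hy : y ∈ Icc a b) (hz : z ∈ Icc a b) :
    ‖f x - f y - (x - y) • f₁ z‖ ≤ L * (b - a) ^ 2 := by
  have hsub : Icc a b ⊆ s := hs.ordConnected.out ha hb
  have hd : ∀ w ∈ Icc a b,
      HasDerivWithinAt (fun w => f w - w • f₁ z) (f₁ w - (1 : ℝ) • f₁ z) (Icc a b) w := fun w hw =>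
    ((hf w (hsub hw)).mono hsub).sub ((hasDerivWithinAt_id w _).smul_const (f₁ z))
  have hbd : ∀ w ∈ Icc a b, ‖f₁ w - (1 : ℝ) • f₁ z‖ ≤ L * (b - a) := fun w hw => by
    rw [one_smul]
    refine (hL w (hsub hw) z (hsub hz)).trans (mul_le_mul_of_nonneg_left ?_ hL0)
    rw [abs_le]
    constructor <;> linarith [hw.1, hw.2, hz.1, hz.2]
  have h := (convex_Icc a b).norm_image_sub_le_of_norm_hasDerivWithin_le hd hbd hy hx
  have h1 : ‖x - y‖ ≤ b - a := by
    rw [Real.norm_eq_abs, abs_le]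
    constructor <;> linarith [hx.1, hx.2, hy.1, hy.2]
  have hab : 0 ≤ b - a := by linarith [hx.1, hx.2]
  calc ‖f x - f y - (x - y) • f₁ z‖ = ‖(f x - x • f₁ z) - (f y - y • f₁ z)‖ := by
        congr 1; module
    _ ≤ L * (b - a) * ‖x - y‖ := h
    _ ≤ L * (b - a) * (b - a) := mul_le_mul_of_nonneg_left h1 (mul_nonneg hL0 hab)
    _ = L * (b - a) ^ 2 := by ring

/-- The first-order expansions of $f(a)$ and $f(b)$ about the midpoint have opposite linear terms,
which cancel in the average. -/
lemma norm_midpoint_sub_average_le (hs : Convex ℝ s)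
    (hf : ∀ x ∈ s, HasDerivWithinAt f (f₁ x) s x)
    (hL : ∀ x ∈ s, ∀ y ∈ s, ‖f₁ x - f₁ y‖ ≤ L * |x - y|) (hL0 : 0 ≤ L) {a b : ℝ}
    (ha : a ∈ s) (hb : b ∈ s) (hab : a ≤ b) :
    ‖f ((a + b) / 2) - (1 / 2 : ℝ) • (f a + f b)‖ ≤ L * (b - a) ^ 2 := by
  have hm : (a + b) / 2 ∈ Icc a b := ⟨by linarith, by linarith⟩
  have h1 := norm_sub_sub_smul_deriv_le hs hf hL hL0 ha hb ⟨le_rfl, hab⟩ hm hm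
  have h2 := norm_sub_sub_smul_deriv_le hs hf hL hL0 ha hb ⟨hab, le_rfl⟩ hm hm
  have e : f ((a + b) / 2) - (1 / 2 : ℝ) • (f a + f b)
      = -((1 / 2 : ℝ) • ((f a - f ((a + b) / 2) - (a - (a + b) / 2) • f₁ ((a + b) / 2))
        + (f b - f ((a + b) / 2) - (b - (a + b) / 2) • f₁ ((a + b) / 2)))) := by
    module
  rw [e, norm_neg, norm_smul]
  refine (mul_le_mul_of_nonneg_left (norm_add_le _ _) (norm_nonneg _)).trans ?_
  rw [Real.norm_of_nonneg (by norm_num)]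
  linarith

/-- The error is viewed as a function of the right endpoint $w$. It vanishes at $w=a$, and its
derivative is half a first-order Taylor remainder of $f_1$, hence at most $L(b-a)^2$; integrating
gains one more power. -/
lemma norm_sub_sub_trapezoid_le (hs : Convex ℝ s)
    (hf : ∀ x ∈ s, HasDerivWithinAt f (f₁ x) s x) (hf₁ : ∀ x ∈ s, HasDerivWithinAt f₁ (f₂ x) s x)
    (hL : ∀ x ∈ s, ∀ y ∈ s, ‖f₂ x - f₂ y‖ ≤ L * |x - y|) (hL0 : 0 ≤ L) {a b : ℝ}
    (ha : a ∈ s) (hb : b ∈ s) (hab : a ≤ b) :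
    ‖f b - f a - ((b - a) / 2) • (f₁ a + f₁ b)‖ ≤ L * (b - a) ^ 3 := by
  have hsub : Icc a b ⊆ s := hs.ordConnected.out ha hb
  have hd : ∀ w ∈ Icc a b, HasDerivWithinAt (fun w => f w - ((w - a) / 2) • (f₁ a + f₁ w))
      (f₁ w - (((w - a) / 2) • f₂ w + (1 / 2 : ℝ) • (f₁ a + f₁ w))) (Icc a b) w := fun w hw =>
    ((hf w (hsub hw)).mono hsub).sub
      ((((hasDerivWithinAt_id w _).sub_const a).div_const 2).smul
        (((hf₁ w (hsub hw)).mono hsub).const_add (f₁ a)))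
  have hbd : ∀ w ∈ Icc a b,
      ‖f₁ w - (((w - a) / 2) • f₂ w + (1 / 2 : ℝ) • (f₁ a + f₁ w))‖ ≤ L * (b - a) ^ 2 := by
    intro w hw
    have h := norm_sub_sub_smul_deriv_le hs hf₁ hL hL0 ha hb hw ⟨le_rfl, hab⟩ hw
    have e : f₁ w - (((w - a) / 2) • f₂ w + (1 / 2 : ℝ) • (f₁ a + f₁ w))
        = (1 / 2 : ℝ) • (f₁ w - f₁ a - (w - a) • f₂ w) := by module
    rw [e, norm_smul, Real.norm_of_nonneg (by norm_num)]
    nlinarith [norm_nonneg (f₁ w - f₁ a - (w - a) • f₂ w)]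
  have h := (convex_Icc a b).norm_image_sub_le_of_norm_hasDerivWithin_le hd hbd
    ⟨le_rfl, hab⟩ ⟨hab, le_rfl⟩
  rw [Real.norm_of_nonneg (sub_nonneg.2 hab)] at h
  calc _ = ‖(f b - ((b - a) / 2) • (f₁ a + f₁ b)) - (f a - ((a - a) / 2) • (f₁ a + f₁ a))‖ := by
        congr 1; module
    _ ≤ _ := h
    _ = _ := by ring

lemma exists_average_error_bound {T : ℝ} (hT : 0 < T) {f : ℝ → E}
    (hf : ContDiffOn ℝ 2 f (Icc 0 T)) :
    ∃ K, 0 ≤ K ∧ ∀ a ∈ Icc 0 T, ∀ b ∈ Icc 0 T, a ≤ b →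
      ‖f ((a + b) / 2) - (1 / 2 : ℝ) • (f a + f b)‖ ≤ K * (b - a) ^ 2 := by
  obtain ⟨L, hL0, hL⟩ := exists_lipschitz_of_contDiffOn_Icc hT
    (hf.derivWithin (m := 1) (uniqueDiffOn_Icc hT) (by norm_num))
  exact ⟨L, hL0, fun a ha b hb hab => norm_midpoint_sub_average_le (convex_Icc 0 T)
    (fun z hz => (hf.differentiableOn (by simp) z hz).hasDerivWithinAt) hL hL0 ha hb hab⟩

lemma exists_trapezoid_error_bound {T : ℝ} (hT : 0 < T) {f : ℝ → E}
    (hf : ContDiffOn ℝ 3 f (Icc 0 T)) :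
    ∃ K, 0 ≤ K ∧ ∀ a ∈ Icc 0 T, ∀ b ∈ Icc 0 T, a ≤ b →
      ‖f b - f a - ((b - a) / 2) •
        (derivWithin f (Icc 0 T) a + derivWithin f (Icc 0 T) b)‖ ≤ K * (b - a) ^ 3 := by
  have hf₁ : ContDiffOn ℝ 2 (derivWithin f (Icc 0 T)) (Icc 0 T) :=
    hf.derivWithin (uniqueDiffOn_Icc hT) (by norm_num)
  obtain ⟨L, hL0, hL⟩ := exists_lipschitz_of_contDiffOn_Icc hT
    (hf₁.derivWithin (m := 1) (uniqueDiffOn_Icc hT) (by norm_num))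
  exact ⟨L, hL0, fun a ha b hb hab => norm_sub_sub_trapezoid_le (convex_Icc 0 T)
    (fun z hz => (hf.differentiableOn (by simp) z hz).hasDerivWithinAt)
    (fun z hz => (hf₁.differentiableOn (by simp) z hz).hasDerivWithinAt) hL hL0 ha hb hab⟩

end TimeQuadrature

/-! ### A right inverse of the discrete divergence from the inf-sup condition. -/

section SaddlePoint

open scoped InnerProductSpace

/-- Let $L:V\to Q$ be `B` followed by the orthogonal projection onto $Q$. The inf-sup condition says
$\|L^*q\|\ge\beta\|q\|$, so $LL^*$ is injective and, in finite dimension, onto. With $LL^*q$ equal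
to the projection of $s$, the witness is $z=L^*q$, and $\|z\|^2=\langle
s,q\rangle\le\|s\|\|z\|/\beta$. -/
lemma exists_mem_of_inf_sup {X P : Type*} [NormedAddCommGroup X] [InnerProductSpace ℝ X]
    [NormedAddCommGroup P] [InnerProductSpace ℝ P] (V : Submodule ℝ X) (Q : Submodule ℝ P)
    [FiniteDimensional ℝ V] [FiniteDimensional ℝ Q] (B : X →ₗ[ℝ] P) {β : ℝ} (hβ : 0 < β)
    (h : ∀ q ∈ Q, q ≠ 0 → β ≤ ⨆ v : {v : X // v ∈ V ∧ v ≠ 0}, ⟪B v.1, q⟫_ℝ / (‖v.1‖ * ‖q‖))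
    (s : P) :
    ∃ z ∈ V, (∀ q ∈ Q, ⟪B z, q⟫_ℝ = ⟪s, q⟫_ℝ) ∧ β * ‖z‖ ≤ ‖s‖ := by
  let L : V →ₗ[ℝ] Q := (Q.orthogonalProjectionOnto : P →ₗ[ℝ] Q) ∘ₗ B ∘ₗ V.subtype
  have hL : ∀ (v : V) (q : Q), ⟪L v, q⟫_ℝ = ⟪B v, (q : P)⟫_ℝ := fun v q =>
    Submodule.inner_orthogonalProjectionOnto_eq_of_mem_right q (B v)
  have hadj : ∀ q : Q, β * ‖q‖ ≤ ‖LinearMap.adjoint L q‖ := by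
    intro q
    by_cases hq : q = 0
    · simp [hq]
    have hq' : 0 < ‖q‖ := norm_pos_iff.2 hq
    rw [← le_div_iff₀ hq']
    -- If `V` is trivial the index type is empty and the real supremum takes its default value 0;
    -- this is why nonnegativity of the bound is also required.
    refine (h q q.2 (by simpa using hq)).trans (Real.iSup_le (fun v => ?_) (by positivity))
    have hv : 0 < ‖v.1‖ := norm_pos_iff.2 v.2.2
    rw [Submodule.norm_coe, div_le_div_iff₀ (by positivity) hq']
    have e : ⟪B v.1, (q : P)⟫_ℝ = ⟪(⟨v.1, v.2.1⟩ : V), LinearMap.adjoint L q⟫_ℝ := by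
      rw [LinearMap.adjoint_inner_right, hL]
    rw [e]
    have := real_inner_le_norm (⟨v.1, v.2.1⟩ : V) (LinearMap.adjoint L q)
    rw [Submodule.coe_norm] at this
    calc _ ≤ (‖v.1‖ * ‖LinearMap.adjoint L q‖) * ‖q‖ :=
          mul_le_mul_of_nonneg_right this hq'.le
      _ = _ := by ring
  have hinj : Function.Injective (L ∘ₗ LinearMap.adjoint L) := by
    rw [← LinearMap.ker_eq_bot, LinearMap.ker_eq_bot']
    intro q hq
    have h0 : ⟪LinearMap.adjoint L q, LinearMap.adjoint L q⟫_ℝ = 0 := by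
      rw [LinearMap.adjoint_inner_right]
      have : L (LinearMap.adjoint L q) = 0 := hq
      rw [this, inner_zero_left]
    rw [inner_self_eq_zero] at h0
    have h1 := hadj q
    rw [h0, norm_zero] at h1
    exact norm_le_zero_iff.1 (by nlinarith [norm_nonneg q])
  obtain ⟨q, hq⟩ := LinearMap.injective_iff_surjective.1 hinj (Q.orthogonalProjectionOnto s)
  have hq' : L (LinearMap.adjoint L q) = Q.orthogonalProjectionOnto s := hq
  refine ⟨LinearMap.adjoint L q, (LinearMap.adjoint L q).2, fun q' hq1 => ?_, ?_⟩
  · rw [← hL _ ⟨q', hq1⟩, hq']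
    exact Submodule.inner_orthogonalProjectionOnto_eq_of_mem_right (⟨q', hq1⟩ : Q) s
  · have h1 : ‖LinearMap.adjoint L q‖ ^ 2 ≤ ‖s‖ * ‖q‖ := by
      rw [← real_inner_self_eq_norm_sq, LinearMap.adjoint_inner_right, hq']
      refine (real_inner_le_norm _ _).trans (mul_le_mul_of_nonneg_right ?_ (norm_nonneg _))
      exact Submodule.norm_orthogonalProjectionOnto_apply_le Q s
    have h2 := hadj q
    rw [Submodule.norm_coe]
    rcases (norm_nonneg (LinearMap.adjoint L q)).eq_or_lt with h0 | h0
    · rw [← h0, mul_zero]; exact norm_nonneg _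
    · nlinarith [norm_nonneg s, norm_nonneg q]

end SaddlePoint

/-! ### Energy estimates for one Crank-Nicolson step, with `J` the embedding into $L^2$ and `G` the
gradient. -/

section CrankNicolson

open scoped InnerProductSpace

variable {X H Y : Type*} [AddCommGroup X] [Module ℝ X]
  [NormedAddCommGroup H] [InnerProductSpace ℝ H] [NormedAddCommGroup Y] [InnerProductSpace ℝ Y]
  (J : X →ₗ[ℝ] H) (G : X →ₗ[ℝ] Y) {x y : X} {ρ : H} {τ K cP : ℝ}

/-- The test function is the increment, so the gradient term is $(\|Gy\|^2-\|Gx\|^2)/2$. Young's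
inequality absorbs the residual into the squared difference quotient. -/
lemma crankNicolson_step_strong (hτ : 0 < τ) (hρ : ‖ρ‖ ≤ τ * K)
    (h : ⟪J (y - x), J (y - x)⟫_ℝ + τ * ⟪G ((1 / 2 : ℝ) • (x + y)), G (y - x)⟫_ℝ
      = ⟪ρ, J (y - x)⟫_ℝ) :
    τ * ‖(1 / τ) • J (y - x)‖ ^ 2 + ‖G y‖ ^ 2 ≤ ‖G x‖ ^ 2 + τ * K ^ 2 := by
  have e1 : ⟪G ((1 / 2 : ℝ) • (x + y)), G (y - x)⟫_ℝ = (‖G y‖ ^ 2 - ‖G x‖ ^ 2) / 2 := by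
    rw [map_smul, map_add, map_sub, real_inner_smul_left, inner_add_left, inner_sub_right,
      inner_sub_right, real_inner_self_eq_norm_sq, real_inner_self_eq_norm_sq,
      real_inner_comm (G x) (G y)]
    ring
  rw [e1, real_inner_self_eq_norm_sq] at h
  have h2 := real_inner_le_norm ρ (J (y - x))
  rw [norm_smul, Real.norm_of_nonneg (by positivity)]
  set N := ‖J (y - x)‖
  have hN : 0 ≤ N := norm_nonneg _
  set z := 1 / τ * N with hz
  have hNz : N = τ * z := by rw [hz]; field_simp
  have h3 : ⟪ρ, J (y - x)⟫_ℝ ≤ τ * K * (τ * z) := by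
    rw [← hNz]; exact h2.trans (mul_le_mul_of_nonneg_right hρ hN)
  rw [← h, hNz] at h3
  have h4 : τ * (τ * z ^ 2 + (‖G y‖ ^ 2 - ‖G x‖ ^ 2) / 2) ≤ τ * (τ * (K * z)) := by
    nlinarith
  have h5 := le_of_mul_le_mul_left h4 hτ
  nlinarith [mul_nonneg hτ.le (sq_nonneg (K - z))]

/-- The test function is the average, so the `J`-term is $(\|Jy\|^2-\|Jx\|^2)/2$. The Poincaré bound
`hP` lets the dissipation absorb the residual. -/
lemma crankNicolson_step_weak (hτ : 0 < τ) (hρ : ‖ρ‖ ≤ τ * K)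
    (hP : ‖J ((1 / 2 : ℝ) • (x + y))‖ ≤ cP * ‖G ((1 / 2 : ℝ) • (x + y))‖) (hK : 0 ≤ K)
    (h : ⟪J (y - x), J ((1 / 2 : ℝ) • (x + y))⟫_ℝ
        + τ * ⟪G ((1 / 2 : ℝ) • (x + y)), G ((1 / 2 : ℝ) • (x + y))⟫_ℝ
      = ⟪ρ, J ((1 / 2 : ℝ) • (x + y))⟫_ℝ) :
    ‖J y‖ ^ 2 + τ * ‖G ((1 / 2 : ℝ) • (x + y))‖ ^ 2 ≤ ‖J x‖ ^ 2 + τ * (cP * K) ^ 2 := by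
  have e1 : ⟪J (y - x), J ((1 / 2 : ℝ) • (x + y))⟫_ℝ = (‖J y‖ ^ 2 - ‖J x‖ ^ 2) / 2 := by
    rw [map_smul, map_add, map_sub, real_inner_smul_right, inner_add_right, inner_sub_left,
      inner_sub_left, real_inner_self_eq_norm_sq, real_inner_self_eq_norm_sq,
      real_inner_comm (J x) (J y)]
    ring
  rw [e1, real_inner_self_eq_norm_sq] at h
  have h2 := real_inner_le_norm ρ (J ((1 / 2 : ℝ) • (x + y)))
  set g := ‖G ((1 / 2 : ℝ) • (x + y))‖
  have h3 : ‖ρ‖ * ‖J ((1 / 2 : ℝ) • (x + y))‖ ≤ (τ * K) * (cP * g) :=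
    mul_le_mul hρ hP (norm_nonneg _) (by positivity)
  nlinarith [mul_nonneg hτ.le (sq_nonneg (cP * K - g))]

end CrankNicolson

lemma sum_add_le_of_step {a E τ : ℕ → ℝ} {K : ℝ} {n : ℕ}
    (h : ∀ m ∈ Finset.Icc 1 n, a m + E m ≤ E (m - 1) + τ m * K) :
    ∑ m ∈ Finset.Icc 1 n, a m + E n ≤ E 0 + (∑ m ∈ Finset.Icc 1 n, τ m) * K := by
  induction n with
  | zero => simp
  | succ n ih =>
    have h1 := ih fun m hm => h m (Finset.Icc_subset_Icc_right n.le_succ hm)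
    have h2 := h (n + 1) (Finset.mem_Icc.2 ⟨by omega, le_rfl⟩)
    rw [Nat.add_sub_cancel] at h2
    rw [Finset.sum_Icc_succ_top (by omega), Finset.sum_Icc_succ_top (by omega)]
    linarith

/-! ### Integration by parts and Poincaré's inequality on $H^1_0(\Omega)$. -/

section Sobolev

open scoped InnerProductSpace

variable {d : ℕ} {Ω : Opens (Pt d)}

/-- The coordinate `w ↦ D^α w`, as a continuous linear map. -/
def sobolevCoord {m : ℕ} (α : MultiIndex d m) : Sobolev m Ω →L[ℝ] L2 Ω :=
  (PiLp.proj 2 (fun _ : MultiIndex d m => L2 Ω) α) ∘L (sobolev d m Ω).subtypeL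

lemma continuous_toL2 {m : ℕ} : Continuous fun w : Sobolev m Ω => w.toL2 :=
  (sobolevCoord (Ω := Ω) (⟨0, by simp⟩ : MultiIndex d m)).continuous

lemma continuous_pderiv {m : ℕ} (hm : 1 ≤ m) (j : Fin d) :
    Continuous fun w : Sobolev m Ω => w.pderiv hm j :=
  (sobolevCoord (Ω := Ω) (⟨Pi.single j 1, by simpa using hm⟩ : MultiIndex d m)).continuous

lemma continuous_laplacian {m : ℕ} (hm : 2 ≤ m) :
    Continuous fun w : Sobolev m Ω => w.laplacian hm :=
  continuous_finsetSum _ fun j _ =>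
    (sobolevCoord (Ω := Ω) (⟨Pi.single j 2, by simpa using hm⟩ : MultiIndex d m)).continuous

lemma hasWeakPDeriv_pderiv {m : ℕ} (hm : 1 ≤ m) (j : Fin d) (w : Sobolev m Ω) :
    HasWeakPDeriv j w.toL2 (w.pderiv hm j) :=
  w.2 _ _ j (by simp)

lemma hasWeakPDeriv_pderiv_pderiv {m : ℕ} (hm : 2 ≤ m) (j : Fin d) (w : Sobolev m Ω) :
    HasWeakPDeriv j (w.pderiv (one_le_two.trans hm) j) (w.1 ⟨Pi.single j 2, by simpa using hm⟩) :=
  w.2 _ _ j (by simp [← Pi.single_add])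

lemma norm_pderiv_le {m : ℕ} (hm : 1 ≤ m) (j : Fin d) (w : Sobolev m Ω) :
    ‖w.pderiv hm j‖ ≤ ‖w‖ :=
  PiLp.norm_apply_le w.1 _

lemma inner_L2_eq (f g : L2 Ω) : ⟪f, g⟫_ℝ = ∫ x in (Ω : Set (Pt d)), f x * g x := by
  rw [L2.inner_def]
  refine integral_congr_ae (Filter.Eventually.of_forall fun x => ?_)
  simp [mul_comm]

lemma integrable_of_continuous_compactSupport {ψ : Pt d → ℝ} (h : Continuous ψ)
    (hc : HasCompactSupport ψ) : Integrable ψ (volume.restrict (Ω : Set (Pt d))) :=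
  (h.integrable_of_hasCompactSupport hc).restrict

variable (φ ψ : TestFunction Ω ℝ ⊤)

lemma continuous_fderiv_testFunction (v : Pt d) : Continuous fun x => fderiv ℝ φ x v :=
  (φ.contDiff.continuous_fderiv (by simp)).clm_apply continuous_const

lemma hasCompactSupport_fderiv_testFunction (v : Pt d) :
    HasCompactSupport fun x => fderiv ℝ φ x v :=
  φ.hasCompactSupport.fderiv_apply ℝ _

lemma testFunction_eq_zero {x : Pt d} (hx : x ∉ (Ω : Set (Pt d))) : φ x = 0 :=
  image_eq_zero_of_notMem_tsupport fun h => hx (φ.tsupport_subset h)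

lemma integral_mul_fderiv_testFunction (v : Pt d) :
    ∫ x in (Ω : Set (Pt d)), φ x * fderiv ℝ ψ x v
      = -∫ x in (Ω : Set (Pt d)), fderiv ℝ φ x v * ψ x := by
  rw [setIntegral_eq_integral_of_forall_compl_eq_zero fun x hx => by
      rw [testFunction_eq_zero φ hx, zero_mul],
    setIntegral_eq_integral_of_forall_compl_eq_zero fun x hx => by
      rw [testFunction_eq_zero ψ hx, mul_zero]]
  refine integral_mul_fderiv_eq_neg_fderiv_mul_of_integrable ?_ ?_ ?_
    (fun x _ => φ.contDiff.differentiable (by simp) x)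
    (fun x _ => ψ.contDiff.differentiable (by simp) x)
  · exact ((continuous_fderiv_testFunction φ v).mul ψ.continuous).integrable_of_hasCompactSupport
      ψ.hasCompactSupport.mul_left
  · exact (φ.continuous.mul (continuous_fderiv_testFunction ψ v)).integrable_of_hasCompactSupport
      φ.hasCompactSupport.mul_right
  · exact (φ.continuous.mul ψ.continuous).integrable_of_hasCompactSupport
      φ.hasCompactSupport.mul_right

variable {φ}

/-- The weak derivative of a test function is its classical derivative. -/
lemma pderiv_ae_eq_fderiv {w : Sobolev 1 Ω}
    (hw : (w.toL2 : Pt d → ℝ) =ᵐ[volume.restrict (Ω : Set (Pt d))] φ) (i : Fin d) :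
    (w.pderiv le_rfl i : Pt d → ℝ) =ᵐ[volume.restrict (Ω : Set (Pt d))]
      fun x => fderiv ℝ φ x (EuclideanSpace.single i 1) := by
  set g := w.pderiv le_rfl i
  set e : Pt d := EuclideanSpace.single i 1
  have hcl := continuous_fderiv_testFunction φ e
  have hg : LocallyIntegrableOn (fun x => g x - fderiv ℝ φ x e) (Ω : Set (Pt d)) := by
    have h1 : LocallyIntegrable (g : Pt d → ℝ) (volume.restrict (Ω : Set (Pt d))) :=
      (Lp.memLp g).locallyIntegrable (by norm_num)
    exact locallyIntegrableOn_of_locallyIntegrable_restrict (h1.sub hcl.locallyIntegrable)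
  -- Fundamental lemma of the calculus of variations: the weak and the classical derivative have
  -- equal integrals against every test function $\chi$.
  have key := Ω.isOpen.ae_eq_zero_of_integral_contDiff_smul_eq_zero hg fun χ hχ hχc hχs => by
    let χ' : TestFunction Ω ℝ ⊤ := ⟨χ, hχ, hχc, hχs⟩
    have h1 := hasWeakPDeriv_pderiv le_rfl i w χ'
    have h2 := integral_mul_fderiv_testFunction φ χ' e
    have h3 : ∫ x in (Ω : Set (Pt d)), w.toL2 x * fderiv ℝ χ' x e
        = ∫ x in (Ω : Set (Pt d)), φ x * fderiv ℝ χ' x e := by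
      refine integral_congr_ae ?_
      filter_upwards [hw] with x hx
      rw [hx]
    have h4 : ∫ x, χ x • (g x - fderiv ℝ φ x e)
        = ∫ x in (Ω : Set (Pt d)), (g x * χ' x - fderiv ℝ φ x e * χ' x) := by
      rw [← setIntegral_eq_integral_of_forall_compl_eq_zero (s := (Ω : Set (Pt d))) fun x hx => by
        rw [show χ x = 0 from testFunction_eq_zero χ' hx, zero_smul]]
      refine integral_congr_ae (Filter.Eventually.of_forall fun x => ?_)
      change χ x • (g x - fderiv ℝ φ x e) = g x * χ x - fderiv ℝ φ x e * χ x
      rw [smul_eq_mul]; ring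
    have h5 : Integrable (fun x => fderiv ℝ φ x e * χ' x) (volume.restrict (Ω : Set (Pt d))) :=
      integrable_of_continuous_compactSupport (hcl.mul χ'.continuous)
        χ'.hasCompactSupport.mul_left
    rw [h4, integral_sub (integrable_mul_of_compactSupport g χ'.continuous χ'.hasCompactSupport) h5]
    rw [h3, h2] at h1
    linarith
  rw [Filter.EventuallyEq, ae_restrict_iff' Ω.isOpen.measurableSet]
  filter_upwards [key] with x hx hxΩ
  linarith [hx hxΩ]

lemma inner_pderiv_of_testFunction {i : Fin d} {f g : L2 Ω} (h : HasWeakPDeriv i f g)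
    {w : Sobolev 1 Ω} (hw : (w.toL2 : Pt d → ℝ) =ᵐ[volume.restrict (Ω : Set (Pt d))] φ) :
    ⟪f, w.pderiv le_rfl i⟫_ℝ = -⟪g, w.toL2⟫_ℝ := by
  rw [inner_L2_eq, inner_L2_eq]
  refine Eq.trans ?_ ((h φ).trans (congrArg _ ?_)) <;> refine integral_congr_ae ?_
  · filter_upwards [pderiv_ae_eq_fderiv hw i] with x hx
    rw [hx]
  · filter_upwards [hw] with x hx
    rw [hx]

variable (φ) in
/-- The test function `x ↦ x_i φ(x)`. -/
def coordMul (i : Fin d) : TestFunction Ω ℝ ⊤ where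
  toFun x := x i * φ x
  contDiff' := (EuclideanSpace.proj i : Pt d →L[ℝ] ℝ).contDiff.mul φ.contDiff
  hasCompactSupport' := φ.hasCompactSupport.mul_left
  tsupport_subset' := (tsupport_mul_subset_right).trans φ.tsupport_subset

/-- Integrating $\varphi\,\partial_i(x_i\varphi)$ by parts gives $\int\varphi^2=-2\int
x_i\varphi\,\partial_i\varphi$. With $|x_i|\le R$ and Young's inequality, half of $\int\varphi^2$ is
absorbed, which leaves the factor $4R^2$. -/
lemma poincare_of_testFunction {R : ℝ} (hR : ∀ x ∈ (Ω : Set (Pt d)), ‖x‖ ≤ R) (i : Fin d)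
    {w : Sobolev 1 Ω} (hw : (w.toL2 : Pt d → ℝ) =ᵐ[volume.restrict (Ω : Set (Pt d))] φ) :
    ‖w.toL2‖ ^ 2 ≤ (2 * R) ^ 2 * ‖w.pderiv le_rfl i‖ ^ 2 := by
  set e : Pt d := EuclideanSpace.single i 1
  have hw' := pderiv_ae_eq_fderiv hw i
  have hcl := continuous_fderiv_testFunction φ e
  have hcs := hasCompactSupport_fderiv_testFunction φ e
  have hd : ∀ x, fderiv ℝ (coordMul φ i) x e = φ x + x i * fderiv ℝ φ x e := fun x => by
    have h1 : HasFDerivAt (fun x : Pt d => x i) (EuclideanSpace.proj i : Pt d →L[ℝ] ℝ) x :=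
      (EuclideanSpace.proj i : Pt d →L[ℝ] ℝ).hasFDerivAt
    have h2 : HasFDerivAt φ (fderiv ℝ φ x) x :=
      (φ.contDiff.differentiable (by simp) x).hasFDerivAt
    have h3 : HasFDerivAt (coordMul φ i)
        (x i • fderiv ℝ φ x + φ x • (EuclideanSpace.proj i : Pt d →L[ℝ] ℝ)) x := h1.mul h2
    rw [h3.fderiv]
    simp [e, add_comm]
  have hci : Continuous fun x : Pt d => x i := (EuclideanSpace.proj i : Pt d →L[ℝ] ℝ).continuous
  have i1 : Integrable (fun x => φ x * φ x) (volume.restrict (Ω : Set (Pt d))) :=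
    integrable_of_continuous_compactSupport (φ.continuous.mul φ.continuous)
      φ.hasCompactSupport.mul_left
  have i2 : Integrable (fun x => φ x * (x i * fderiv ℝ φ x e))
      (volume.restrict (Ω : Set (Pt d))) :=
    integrable_of_continuous_compactSupport (φ.continuous.mul (hci.mul hcl))
      φ.hasCompactSupport.mul_right
  have i3 : Integrable (fun x => fderiv ℝ φ x e * fderiv ℝ φ x e)
      (volume.restrict (Ω : Set (Pt d))) :=
    integrable_of_continuous_compactSupport (hcl.mul hcl) hcs.mul_left
  have h1 : ∫ x in (Ω : Set (Pt d)), φ x * φ x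
      = -(2 * ∫ x in (Ω : Set (Pt d)), φ x * (x i * fderiv ℝ φ x e)) := by
    have h := integral_mul_fderiv_testFunction φ (coordMul φ i) e
    have e1 : ∫ x in (Ω : Set (Pt d)), φ x * fderiv ℝ (coordMul φ i) x e
        = ∫ x in (Ω : Set (Pt d)), (φ x * φ x + φ x * (x i * fderiv ℝ φ x e)) :=
      integral_congr_ae (Filter.Eventually.of_forall fun x => by
        simp only [hd]; ring)
    have e2 : ∫ x in (Ω : Set (Pt d)), fderiv ℝ φ x e * coordMul φ i x
        = ∫ x in (Ω : Set (Pt d)), φ x * (x i * fderiv ℝ φ x e) :=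
      integral_congr_ae (Filter.Eventually.of_forall fun x => by
        change fderiv ℝ φ x e * (x i * φ x) = _; ring)
    rw [e1, e2, integral_add i1 i2] at h
    linarith
  have h2 : ∫ x in (Ω : Set (Pt d)), -(2 * (φ x * (x i * fderiv ℝ φ x e)))
      ≤ ∫ x in (Ω : Set (Pt d)), ((1 / 2) * (φ x * φ x)
        + 2 * R ^ 2 * (fderiv ℝ φ x e * fderiv ℝ φ x e)) := by
    refine setIntegral_mono_on (i2.const_mul 2).neg ((i1.const_mul _).add (i3.const_mul _))
      Ω.isOpen.measurableSet fun x hx => ?_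
    have hxi : x i ^ 2 ≤ R ^ 2 := by
      have := (PiLp.norm_apply_le x i).trans (hR x hx)
      rw [Real.norm_eq_abs] at this
      exact sq_le_sq' (by linarith [neg_abs_le (x i)]) ((le_abs_self _).trans this)
    nlinarith [sq_nonneg (φ x + 2 * (x i * fderiv ℝ φ x e)),
      mul_le_mul_of_nonneg_right hxi (sq_nonneg (fderiv ℝ φ x e))]
  rw [integral_neg, integral_const_mul, integral_add (i1.const_mul _) (i3.const_mul _),
    integral_const_mul, integral_const_mul] at h2
  have e3 : ‖w.toL2‖ ^ 2 = ∫ x in (Ω : Set (Pt d)), φ x * φ x := by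
    rw [← real_inner_self_eq_norm_sq, inner_L2_eq]
    refine integral_congr_ae ?_
    filter_upwards [hw] with x hx
    rw [hx]
  have e4 : ‖w.pderiv le_rfl i‖ ^ 2
      = ∫ x in (Ω : Set (Pt d)), fderiv ℝ φ x e * fderiv ℝ φ x e := by
    rw [← real_inner_self_eq_norm_sq, inner_L2_eq]
    refine integral_congr_ae ?_
    filter_upwards [hw'] with x hx
    rw [hx]
  rw [e3, e4]
  linarith

/-- A closed property of the elements of `H^1(Ω)` given by test functions holds on `H^1_0(Ω)`. -/
lemma H10_induction {P : Sobolev 1 Ω → Prop} (hP : IsClosed {w | P w})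
    (h : ∀ (w : Sobolev 1 Ω) (φ : TestFunction Ω ℝ ⊤),
      (w.toL2 : Pt d → ℝ) =ᵐ[volume.restrict (Ω : Set (Pt d))] φ → P w)
    {w : Sobolev 1 Ω} (hw : w ∈ H10 Ω) : P w := by
  -- The span adds nothing: elements represented by test functions are already closed under linear
  -- combinations.
  have key : ∀ w ∈ Submodule.span ℝ {w : Sobolev 1 Ω | ∃ φ : TestFunction Ω ℝ ⊤,
      (w.toL2 : Pt d → ℝ) =ᵐ[volume.restrict (Ω : Set (Pt d))] φ}, ∃ φ : TestFunction Ω ℝ ⊤,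
      (w.toL2 : Pt d → ℝ) =ᵐ[volume.restrict (Ω : Set (Pt d))] φ := by
    intro w hw
    induction hw using Submodule.span_induction with
    | mem w hw => exact hw
    | zero => exact ⟨0, Lp.coeFn_zero ℝ 2 _⟩
    | add v w _ _ hv hw =>
      obtain ⟨φ, hφ⟩ := hv
      obtain ⟨ψ, hψ⟩ := hw
      exact ⟨φ + ψ, (Lp.coeFn_add v.toL2 w.toL2).trans (hφ.add hψ)⟩
    | smul c w _ hw =>
      obtain ⟨φ, hφ⟩ := hw
      exact ⟨c • φ, (Lp.coeFn_smul c w.toL2).trans (hφ.const_smul c)⟩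
  have hw' : w ∈ closure ((Submodule.span ℝ {w : Sobolev 1 Ω | ∃ φ : TestFunction Ω ℝ ⊤,
      (w.toL2 : Pt d → ℝ) =ᵐ[volume.restrict (Ω : Set (Pt d))] φ} :
        Submodule ℝ (Sobolev 1 Ω)) : Set (Sobolev 1 Ω)) := hw
  refine closure_minimal (t := {w | P w}) (fun v hv => ?_) hP hw'
  obtain ⟨φ, hφ⟩ := key v hv
  exact h v φ hφ

/-- Integration by parts against `H^1_0(Ω)`. -/
lemma HasWeakPDeriv.inner_pderiv {i : Fin d} {f g : L2 Ω} (h : HasWeakPDeriv i f g)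
    {w : Sobolev 1 Ω} (hw : w ∈ H10 Ω) : ⟪f, w.pderiv le_rfl i⟫_ℝ = -⟪g, w.toL2⟫_ℝ :=
  H10_induction (P := fun w => ⟪f, w.pderiv le_rfl i⟫_ℝ = -⟪g, w.toL2⟫_ℝ)
    (isClosed_eq (continuous_const.inner (continuous_pderiv le_rfl i))
      (continuous_const.inner continuous_toL2).neg)
    (fun _ _ hφ => inner_pderiv_of_testFunction h hφ) hw

/-- Poincaré's inequality. -/
lemma poincare {R : ℝ} (hR : ∀ x ∈ (Ω : Set (Pt d)), ‖x‖ ≤ R) (i : Fin d)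
    {w : Sobolev 1 Ω} (hw : w ∈ H10 Ω) :
    ‖w.toL2‖ ^ 2 ≤ (2 * R) ^ 2 * ‖w.pderiv le_rfl i‖ ^ 2 :=
  H10_induction (P := fun w => ‖w.toL2‖ ^ 2 ≤ (2 * R) ^ 2 * ‖w.pderiv le_rfl i‖ ^ 2)
    (isClosed_le (continuous_toL2.norm.pow 2)
      (continuous_const.mul ((continuous_pderiv le_rfl i).norm.pow 2)))
    (fun _ _ hφ => poincare_of_testFunction hR i hφ) hw

end Sobolev

/-! ### Gradient, divergence and Green's formulas for vector fields. -/

section VectorSobolev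

open scoped InnerProductSpace

variable {d : ℕ} {Ω : Opens (Pt d)}

instance vecSobolevInnerProductSpace (m : ℕ) : InnerProductSpace ℝ (VecSobolev m Ω) :=
  PiLp.innerProductSpace _

instance vecSobolevT2Space (m : ℕ) : T2Space (VecSobolev m Ω) := t2Space_of_metrizableSpace

/-- The inclusion `H^m(Ω)^d → L²(Ω)^d` as a linear map. -/
def vecToL2 {m : ℕ} : VecSobolev m Ω →ₗ[ℝ] VecL2 Ω where
  toFun v := v.toL2
  map_add' _ _ := rfl
  map_smul' _ _ := rfl

/-- The gradient `H^1(Ω)^d → L²(Ω)^{d × d}`. -/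
def grad : VecSobolev 1 Ω →ₗ[ℝ] PiLp 2 (fun _ : Fin d × Fin d => L2 Ω) where
  toFun v := WithLp.toLp 2 fun ij => (v ij.1).pderiv le_rfl ij.2
  map_add' _ _ := rfl
  map_smul' _ _ := rfl

/-- The divergence `H^1(Ω)^d → L²(Ω)` as a linear map. -/
def divLin : VecSobolev 1 Ω →ₗ[ℝ] L2 Ω where
  toFun v := divergence le_rfl v
  map_add' v w := by
    simp only [divergence]
    exact Finset.sum_add_distrib
  map_smul' c v := by
    simp only [divergence, RingHom.id_apply]
    exact (Finset.smul_sum (r := c) (f := fun i => (v i).pderiv le_rfl i)).symm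

lemma aForm_eq_inner_grad (v w : VecSobolev 1 Ω) : aForm v w = ⟪grad v, grad w⟫_ℝ := by
  rw [PiLp.inner_apply, Fintype.sum_prod_type]
  rfl

lemma gradNorm_eq (v : VecSobolev 1 Ω) : gradNorm v = ‖grad v‖ := by
  rw [gradNorm, aForm_eq_inner_grad, norm_eq_sqrt_real_inner]

lemma norm_grad_sq (v : VecSobolev 1 Ω) :
    ‖grad v‖ ^ 2 = ∑ i, ∑ j, ‖(v i).pderiv le_rfl j‖ ^ 2 := by
  rw [PiLp.norm_sq_eq_of_L2, Fintype.sum_prod_type]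
  rfl

lemma norm_grad_le (v : VecSobolev 1 Ω) : ‖grad v‖ ≤ d * ‖v‖ := by
  refine le_of_sq_le_sq ?_ (by positivity)
  rw [norm_grad_sq]
  calc ∑ i, ∑ j, ‖(v i).pderiv le_rfl j‖ ^ 2 ≤ ∑ _i : Fin d, ∑ _j : Fin d, ‖v‖ ^ 2 := by
        refine Finset.sum_le_sum fun i _ => Finset.sum_le_sum fun j _ => ?_
        gcongr
        exact (norm_pderiv_le _ j (v i)).trans (PiLp.norm_apply_le v i)
    _ = (d * ‖v‖) ^ 2 := by simp; ring

lemma norm_divergence_le (v : VecSobolev 1 Ω) : ‖divLin v‖ ≤ d * ‖grad v‖ := by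
  refine (norm_sum_le Finset.univ fun i => (v i).pderiv le_rfl i).trans ?_
  calc ∑ i, ‖(v i).pderiv le_rfl i‖ ≤ ∑ _i : Fin d, ‖grad v‖ :=
        Finset.sum_le_sum fun i _ => PiLp.norm_apply_le (grad v) (i, i)
    _ = d * ‖grad v‖ := by simp

lemma poincare_velocitySpace (hd : 0 < d) {R : ℝ} (hR0 : 0 ≤ R)
    (hR : ∀ x ∈ (Ω : Set (Pt d)), ‖x‖ ≤ R) {v : VecSobolev 1 Ω} (hv : v ∈ velocitySpace Ω) :
    ‖vecToL2 v‖ ≤ 2 * R * ‖grad v‖ := by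
  refine le_of_sq_le_sq ?_ (by positivity)
  rw [mul_pow, norm_grad_sq, PiLp.norm_sq_eq_of_L2, Finset.mul_sum]
  refine Finset.sum_le_sum fun i _ => (poincare hR ⟨0, hd⟩ (hv i)).trans ?_
  refine mul_le_mul_of_nonneg_left ?_ (sq_nonneg _)
  exact Finset.single_le_sum (f := fun j => ‖(v i).pderiv le_rfl j‖ ^ 2)
    (fun _ _ => sq_nonneg _) (Finset.mem_univ _)

/-- No boundary term arises because the components of `w` lie in $H^1_0(\Omega)$. This and
`inner_grad_incl_eq` turn the strong momentum equation into its weak form. -/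
lemma bForm_pressure_eq {m : ℕ} (hm : 1 ≤ m) (q : Sobolev m Ω) {w : VecSobolev 1 Ω}
    (hw : w ∈ velocitySpace Ω) :
    bForm w q.toL2 = ∑ i, ⟪q.pderiv hm i, (w i).toL2⟫_ℝ := by
  rw [bForm, divergence, sum_inner, ← Finset.sum_neg_distrib]
  refine Finset.sum_congr rfl fun i _ => ?_
  rw [real_inner_comm, (hasWeakPDeriv_pderiv hm i q).inner_pderiv (hw i), neg_neg]

lemma inner_grad_incl_eq {m : ℕ} (hm : 2 ≤ m) (v : VecSobolev m Ω) {w : VecSobolev 1 Ω}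
    (hw : w ∈ velocitySpace Ω) :
    ⟪grad (v.incl (one_le_two.trans hm)), grad w⟫_ℝ
      = -∑ i, ⟪(v i).laplacian hm, (w i).toL2⟫_ℝ := by
  rw [← aForm_eq_inner_grad, aForm, ← Finset.sum_neg_distrib]
  refine Finset.sum_congr rfl fun i _ => ?_
  rw [Sobolev.laplacian, sum_inner, ← Finset.sum_neg_distrib]
  exact Finset.sum_congr rfl fun j _ =>
    (hasWeakPDeriv_pderiv_pderiv hm j (v i)).inner_pderiv (hw i)

end VectorSobolev

/-! ### The Stokes system on the closed time interval, and its weak form. -/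

section Stokes

open scoped InnerProductSpace

variable {d : ℕ} {Ω : Opens (Pt d)} {T : ℝ} {r : ℕ} {hr : 1 ≤ r}
  {f : ℝ → VecL2 Ω} {u₀ : VecL2 Ω} {u : ℝ → VecSobolev (r + 1) Ω} {p : ℝ → Sobolev r Ω}

lemma subset_closure_Ioc (hT : 0 < T) : Icc 0 T ⊆ closure (Ioc 0 T) := by
  rw [closure_Ioc hT.ne]

/-- Both sides are continuous up to $t=0$, so the equation extends there. The value at 0 is needed
because the first trapezoidal rule uses $f(t_0)$. -/
lemma IsRegularStokesSolution.momentum_Icc (hu : IsRegularStokesSolution Ω T r hr f u₀ u p)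
    (hT : 0 < T) (i : Fin d) {t : ℝ} (ht : t ∈ Icc 0 T) :
    (derivWithin (fun s => (u s).toL2) (Icc 0 T) t) i
      - (u t i).laplacian (Nat.add_le_add_right hr 1) + (p t).pderiv hr i = f t i := by
  refine EqOn.of_subset_closure (s := Ioc 0 T) (t := Icc 0 T)
    (f := fun t => (derivWithin (fun s => (u s).toL2) (Icc 0 T) t) i
      - (u t i).laplacian (Nat.add_le_add_right hr 1) + (p t).pderiv hr i)
    (g := fun t => f t i)
    (fun t ht => hu.momentum t ht i) ?_ ?_ Ioc_subset_Icc_self (subset_closure_Ioc hT) ht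
  · refine ((ContinuousOn.sub ?_ ?_).add ?_)
    · exact (PiLp.continuous_apply 2 _ i).comp_continuousOn
        (hu.u_reg_L2.continuousOn_derivWithin (uniqueDiffOn_Icc hT) (by norm_num))
    · exact ((continuous_laplacian (Nat.add_le_add_right hr 1)).comp (PiLp.continuous_apply 2 _ i)).comp_continuousOn
        hu.u_reg.continuousOn
    · exact (continuous_pderiv hr i).comp_continuousOn hu.p_reg.continuousOn
  · exact (PiLp.continuous_apply 2 _ i).comp_continuousOn hu.f_cont

lemma IsRegularStokesSolution.divergence_eq_zero
    (hu : IsRegularStokesSolution Ω T r hr f u₀ u p) (hT : 0 < T) {t : ℝ} (ht : t ∈ Icc 0 T) :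
    divLin ((u t).incl (Nat.le_add_left 1 r)) = 0 := by
  refine EqOn.of_subset_closure (s := Ioc 0 T) (t := Icc 0 T)
    (f := fun t => divergence (Nat.le_add_left 1 r) (u t)) (g := fun _ => 0)
    (fun t ht => hu.div_free t ht) ?_ continuousOn_const Ioc_subset_Icc_self
    (subset_closure_Ioc hT) ht
  refine continuousOn_finsetSum _ fun i _ => ?_
  exact (((continuous_pderiv (Ω := Ω) (Nat.le_add_left 1 r) i)).comp
    (PiLp.continuous_apply 2 (fun _ : Fin d => Sobolev (r + 1) Ω) i)).comp_continuousOn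
      hu.u_reg.continuousOn

/-- The weak form of the momentum equation. -/
lemma IsRegularStokesSolution.weak_momentum
    (hu : IsRegularStokesSolution Ω T r hr f u₀ u p) (hT : 0 < T) {t : ℝ} (ht : t ∈ Icc 0 T)
    {w : VecSobolev 1 Ω} (hw : w ∈ velocitySpace Ω) :
    ⟪derivWithin (fun s => (u s).toL2) (Icc 0 T) t, vecToL2 w⟫_ℝ
      + ⟪grad ((u t).incl (Nat.le_add_left 1 r)), grad w⟫_ℝ + bForm w (p t).toL2
      = ⟪f t, vecToL2 w⟫_ℝ := by
  rw [inner_grad_incl_eq (Nat.add_le_add_right hr 1) (u t) hw, bForm_pressure_eq hr (p t) hw,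
    PiLp.inner_apply, PiLp.inner_apply, ← Finset.sum_neg_distrib, ← Finset.sum_add_distrib,
    ← Finset.sum_add_distrib]
  refine Finset.sum_congr rfl fun i _ => ?_
  rw [← hu.momentum_Icc hT i ht, inner_add_left, inner_sub_left]
  change _ + _ + _ = _ - ⟪_, (w i).toL2⟫_ℝ + ⟪_, (w i).toL2⟫_ℝ
  rw [← sub_eq_add_neg]

end Stokes

/-! ### The Stokes projection onto $V_h^{\rm div}$ and its error. -/

section RitzProjection

open scoped InnerProductSpace

variable {d : ℕ} {Ω : Opens (Pt d)}

/-- `V_h^div` as a subspace. -/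
def discreteDivFreeSubmodule (Vh : Submodule ℝ (VecSobolev 1 Ω)) (Qh : Submodule ℝ (L2 Ω)) :
    Submodule ℝ (VecSobolev 1 Ω) where
  carrier := discreteDivFree Vh Qh
  add_mem' := fun {v w} hv hw => ⟨Vh.add_mem hv.1 hw.1, fun q hq => by
    have h1 : -⟪divLin v, q⟫_ℝ = 0 := hv.2 q hq
    have h2 : -⟪divLin w, q⟫_ℝ = 0 := hw.2 q hq
    change -⟪divLin (v + w), q⟫_ℝ = 0
    rw [map_add, inner_add_left]; linarith⟩
  zero_mem' := ⟨Vh.zero_mem, fun q _ => by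
    change -⟪divLin (0 : VecSobolev 1 Ω), q⟫_ℝ = 0
    rw [map_zero, inner_zero_left, neg_zero]⟩
  smul_mem' := fun c v hv => ⟨Vh.smul_mem c hv.1, fun q hq => by
    have h1 : -⟪divLin v, q⟫_ℝ = 0 := hv.2 q hq
    change -⟪divLin (c • v), q⟫_ℝ = 0
    rw [map_smul, real_inner_smul_left, neg_eq_zero.1 h1, mul_zero, neg_zero]⟩

/-- `q I`, so that `⟨q I, ∇w⟩ = ⟨q, ∇ · w⟩`. -/
def scalarTensor (q : L2 Ω) : PiLp 2 (fun _ : Fin d × Fin d => L2 Ω) :=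
  WithLp.toLp 2 fun ij => if ij.1 = ij.2 then q else 0

lemma inner_scalarTensor (q : L2 Ω) (w : VecSobolev 1 Ω) :
    ⟪scalarTensor q, grad w⟫_ℝ = -bForm w q := by
  have h : ∀ i j : Fin d, ⟪if i = j then q else 0, (w i).pderiv le_rfl j⟫_ℝ
      = if i = j then ⟪(w i).pderiv le_rfl i, q⟫_ℝ else 0 := fun i j => by
    split_ifs with hij
    · rw [hij, real_inner_comm]
    · rw [inner_zero_left]
  rw [bForm, neg_neg, divergence, sum_inner, PiLp.inner_apply, Fintype.sum_prod_type]
  refine Finset.sum_congr rfl fun i _ => ?_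
  refine (Finset.sum_congr rfl fun j _ => h i j).trans ?_
  simp

/-- Existence of the Stokes projection. -/
lemma exists_stokes_projection (W : Submodule ℝ (VecSobolev 1 Ω)) [FiniteDimensional ℝ W]
    (v : VecSobolev 1 Ω) (q : L2 Ω) :
    ∃ θ ∈ W, ∀ w ∈ W, ⟪grad θ, grad w⟫_ℝ = ⟪grad v, grad w⟫_ℝ + bForm w q := by
  -- Projecting in $L^2$ onto the finite-dimensional space of gradients of `W` avoids any coercivity
  -- argument; `scalarTensor q` represents $-b(\cdot,q)$.
  obtain ⟨θ, hθ, hθ'⟩ := ((W.map grad).orthogonalProjectionOnto (grad v - scalarTensor q)).2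
  refine ⟨θ, hθ, fun w hw => ?_⟩
  rw [hθ']
  have := Submodule.inner_orthogonalProjectionOnto_eq_of_mem_left
    (⟨grad w, w, hw, rfl⟩ : W.map grad) (grad v - scalarTensor q)
  rw [real_inner_comm]
  refine this.trans ?_
  rw [real_inner_comm, inner_sub_left, inner_scalarTensor, sub_neg_eq_add]

variable {r : ℕ} {β cA h : ℝ} {Vh : Submodule ℝ (VecSobolev 1 Ω)} {Qh : Submodule ℝ (L2 Ω)}

lemma bForm_eq_inner (v : VecSobolev 1 Ω) (q : L2 Ω) : bForm v q = ⟪(-divLin) v, q⟫_ℝ := by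
  rw [LinearMap.neg_apply, inner_neg_left]
  rfl

lemma IsFEPair.exists_bForm_lift (hFE : IsFEPair Ω r β cA h Vh Qh) (hβ : 0 < β)
    (v : VecSobolev 1 Ω) :
    ∃ z ∈ Vh, (∀ q ∈ Qh, bForm z q = bForm v q) ∧ β * ‖z‖ ≤ ‖divLin v‖ := by
  have := hFE.finite_V
  have := hFE.finite_Q
  obtain ⟨z, hz, hzq, hzn⟩ := exists_mem_of_inf_sup (X := VecSobolev 1 Ω) (P := L2 Ω) Vh Qh
    (-divLin) hβ (fun q hq hq0 => (hFE.inf_sup q hq hq0).trans_eq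
      (iSup_congr fun v => by rw [bForm_eq_inner])) ((-divLin) v)
  refine ⟨z, hz, fun q hq => ?_, ?_⟩
  · rw [bForm_eq_inner, bForm_eq_inner, hzq q hq]
  · rwa [LinearMap.neg_apply, norm_neg] at hzn

/-- An approximant $v_h\in V_h$ is corrected by $z\in V_h$ with $b(z,\cdot)=b(v-v_h,\cdot)$ on
$Q_h$; as $\nabla\cdot v=0$, the sum $v_h+z$ is discretely divergence-free. The inf-sup bound makes
$z$ as small as $v-v_h$. One factor `d` bounds the divergence by the gradient, the other the
gradient by the $H^1$ norm. -/
lemma IsFEPair.exists_discreteDivFree_approx (hFE : IsFEPair Ω r β cA h Vh Qh) (hβ : 0 < β)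
    {v : VecSobolev (r + 1) Ω} (hv : v.incl (Nat.le_add_left 1 r) ∈ velocitySpace Ω)
    (hdiv : divLin (v.incl (Nat.le_add_left 1 r)) = 0) :
    ∃ w ∈ discreteDivFree Vh Qh,
      ‖grad (v.incl (Nat.le_add_left 1 r) - w)‖
        ≤ (1 + d * d / β) * (|cA| * h ^ r * ‖v‖) := by
  have hh := hFE.h_pos
  obtain ⟨vh, hvh, happ⟩ := hFE.approx_V v hv
  set V := v.incl (Nat.le_add_left 1 r)
  -- The sign of `cA` is not assumed, hence the absolute value.
  have h1 : ‖grad (V - vh)‖ ≤ |cA| * h ^ r * ‖v‖ := by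
    rw [gradNorm_eq] at happ
    have h2 : h * ‖grad (V - vh)‖ ≤ h * (|cA| * h ^ r * ‖v‖) := by
      calc h * ‖grad (V - vh)‖ ≤ cA * h ^ (r + 1) * ‖v‖ := by
            linarith [norm_nonneg (v.toL2 - vh.toL2)]
        _ ≤ |cA| * h ^ (r + 1) * ‖v‖ := by gcongr; exact le_abs_self cA
        _ = _ := by ring
    exact le_of_mul_le_mul_left h2 hh
  obtain ⟨z, hz, hzq, hzn⟩ := hFE.exists_bForm_lift hβ (V - vh)
  refine ⟨vh + z, ⟨Vh.add_mem hvh hz, fun q hq => ?_⟩, ?_⟩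
  · have h2 := hzq q hq
    change -⟪divLin z, q⟫_ℝ = -⟪divLin (V - vh), q⟫_ℝ at h2
    rw [map_sub, hdiv, zero_sub, inner_neg_left] at h2
    change -⟪divLin (vh + z), q⟫_ℝ = 0
    rw [map_add, inner_add_left]
    linarith
  · have h3 : ‖grad z‖ ≤ d * d / β * ‖grad (V - vh)‖ := by
      have h4 : β * ‖z‖ ≤ d * ‖grad (V - vh)‖ := hzn.trans (norm_divergence_le _)
      have h5 : ‖z‖ ≤ d * ‖grad (V - vh)‖ / β := by
        rw [le_div_iff₀ hβ]; linarith
      calc ‖grad z‖ ≤ d * ‖z‖ := norm_grad_le z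
        _ ≤ d * (d * ‖grad (V - vh)‖ / β) := by gcongr
        _ = _ := by ring
    calc ‖grad (V - (vh + z))‖ = ‖grad (V - vh) - grad z‖ := by
          rw [← map_sub]; congr 2; abel
      _ ≤ ‖grad (V - vh)‖ + ‖grad z‖ := norm_sub_le _ _
      _ ≤ (1 + d * d / β) * ‖grad (V - vh)‖ := by linarith
      _ ≤ _ := by gcongr

/-- The error of the Stokes projection. -/
lemma IsFEPair.norm_grad_sub_stokes_projection_le (hFE : IsFEPair Ω r β cA h Vh Qh) (hβ : 0 < β)
    {v : VecSobolev (r + 1) Ω} (hv : v.incl (Nat.le_add_left 1 r) ∈ velocitySpace Ω)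
    (hdiv : divLin (v.incl (Nat.le_add_left 1 r)) = 0)
    {q : Sobolev r Ω} (hq : q.toL2 ∈ pressureSpace Ω)
    {θ : VecSobolev 1 Ω} (hθ : θ ∈ discreteDivFree Vh Qh)
    (hθ' : ∀ w ∈ discreteDivFree Vh Qh, ⟪grad θ, grad w⟫_ℝ
      = ⟪grad (v.incl (Nat.le_add_left 1 r)), grad w⟫_ℝ + bForm w q.toL2) :
    ‖grad (v.incl (Nat.le_add_left 1 r) - θ)‖
      ≤ (2 * (1 + d * d / β) + d) * |cA| * h ^ r * (‖v‖ + ‖q‖) := by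
  have hh := hFE.h_pos
  obtain ⟨w, hw, happ⟩ := hFE.exists_discreteDivFree_approx hβ hv hdiv
  obtain ⟨qh, hqh, hqa⟩ := hFE.approx_Q q hq
  set V := v.incl (Nat.le_add_left 1 r)
  have hW : θ - w ∈ discreteDivFreeSubmodule Vh Qh :=
    (discreteDivFreeSubmodule Vh Qh).sub_mem hθ hw
  -- Céa's argument: `qh` may be subtracted from the pressure because $\theta-w$ is discretely
  -- divergence-free.
  have h1 : ‖grad (θ - w)‖ ^ 2
      = ⟪grad (V - w), grad (θ - w)⟫_ℝ - ⟪divLin (θ - w), q.toL2 - qh⟫_ℝ := by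
    have h2 := hθ' _ hW
    have h3 : -⟪divLin (θ - w), qh⟫_ℝ = 0 := hW.2 qh hqh
    change _ = _ + -⟪divLin (θ - w), q.toL2⟫_ℝ at h2
    rw [← real_inner_self_eq_norm_sq, map_sub grad V w, inner_sub_right (divLin (θ - w)),
      inner_sub_left (grad V)]
    nth_rw 1 [map_sub grad θ w]
    rw [inner_sub_left, h2]
    linarith
  have h2 : ‖grad (θ - w)‖ ≤ ‖grad (V - w)‖ + d * ‖q.toL2 - qh‖ := by
    have h3 := real_inner_le_norm (grad (V - w)) (grad (θ - w))
    have h4 := neg_le_of_abs_le (abs_real_inner_le_norm (divLin (θ - w)) (q.toL2 - qh))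
    have h5 := mul_le_mul_of_nonneg_right (norm_divergence_le (θ - w))
      (norm_nonneg (q.toL2 - qh))
    rcases (norm_nonneg (grad (θ - w))).eq_or_lt with h0 | h0
    · rw [← h0]; positivity
    · refine le_of_mul_le_mul_right ?_ h0
      nlinarith
  have h3 : ‖q.toL2 - qh‖ ≤ |cA| * h ^ r * ‖q‖ :=
    hqa.trans (by gcongr; exact le_abs_self cA)
  have e : V - θ = (V - w) - (θ - w) := by abel
  rw [e, map_sub grad]
  refine (norm_sub_le _ _).trans ?_
  have h4 : (d : ℝ) * ‖q.toL2 - qh‖ ≤ d * (|cA| * h ^ r * ‖q‖) := by gcongr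
  have h5 : 0 ≤ (d : ℝ) * (|cA| * h ^ r * ‖v‖) := by positivity
  have h6 : 0 ≤ (2 * (1 + d * d / β)) * (|cA| * h ^ r * ‖q‖) := by positivity
  calc _ ≤ 2 * ((1 + d * d / β) * (|cA| * h ^ r * ‖v‖)) + d * (|cA| * h ^ r * ‖q‖) := by linarith
    _ ≤ 2 * ((1 + d * d / β) * (|cA| * h ^ r * ‖v‖)) + d * (|cA| * h ^ r * ‖q‖)
        + d * (|cA| * h ^ r * ‖v‖) + (2 * (1 + d * d / β)) * (|cA| * h ^ r * ‖q‖) := by linarith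
    _ = _ := by ring

end RitzProjection

/-! ### The time mesh, and the discrete solution as a Crank-Nicolson sequence. -/

namespace TimeMesh

variable {T : ℝ} (M : TimeMesh T)

lemma monotone {m n : ℕ} (hmn : m ≤ n) (hn : n ≤ M.N) : M.t m ≤ M.t n := by
  induction n, hmn using Nat.le_induction with
  | base => exact le_rfl
  | succ k _ ih => exact (ih (by omega)).trans (M.t_lt k (by omega)).le

lemma t_mem {m : ℕ} (hm : m ≤ M.N) : M.t m ∈ Icc 0 T := by
  have h0 := M.monotone (Nat.zero_le m) hm
  have h1 := M.monotone hm le_rfl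
  rw [M.t_zero] at h0
  rw [M.t_last] at h1
  exact ⟨h0, h1⟩

lemma t_pred_lt {m : ℕ} (hm : m ∈ Finset.Icc 1 M.N) : M.t (m - 1) < M.t m := by
  obtain ⟨h1, h2⟩ := Finset.mem_Icc.1 hm
  have := M.t_lt (m - 1) (by omega)
  rwa [Nat.sub_add_cancel h1] at this

lemma len_pos {m : ℕ} (hm : m ∈ Finset.Icc 1 M.N) : 0 < M.len m :=
  sub_pos.2 (M.t_pred_lt hm)

lemma len_le_size {m : ℕ} (hm : m ∈ Finset.Icc 1 M.N) : M.len m ≤ M.size := by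
  obtain ⟨h1, h2⟩ := Finset.mem_Icc.1 hm
  have := le_ciSup (f := fun n : Fin M.N => M.len (n + 1)) (Set.finite_range _).bddAbove
    ⟨m - 1, by omega⟩
  rwa [Nat.sub_add_cancel h1] at this

lemma sum_len_le {n : ℕ} (hn : n ≤ M.N) : ∑ m ∈ Finset.Icc 1 n, M.len m ≤ T := by
  have : ∀ n, ∑ m ∈ Finset.Icc 1 n, M.len m = M.t n := fun n => by
    induction n with
    | zero => simp [M.t_zero]
    | succ k ih =>
      rw [Finset.sum_Icc_succ_top (by omega), ih, len, Nat.add_sub_cancel]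
      ring
  rw [this]
  exact (M.t_mem hn).2

end TimeMesh

section DiscreteSolution

open scoped InnerProductSpace

variable {d : ℕ} {Ω : Opens (Pt d)} {T : ℝ} {f : ℝ → VecL2 Ω}
    {Vh : Submodule ℝ (VecSobolev 1 Ω)} {Qh : Submodule ℝ (L2 Ω)} {M : TimeMesh T}
    {u₀h : VecSobolev 1 Ω} {uh : ℝ → VecSobolev 1 Ω} {ph : ℝ → L2 Ω}

lemma isPolyOn_zero_const {X : Type*} [AddCommGroup X] [Module ℝ X] {B : Submodule ℝ X} {x : X}
    (hx : x ∈ B) (I : Set ℝ) : IsPolyOn 0 I B fun _ => x :=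
  ⟨fun _ => x, fun _ => hx, fun t _ => by simp⟩

lemma integral_affine (a b k l : ℝ) :
    ∫ s in a..b, (k + s * l) = (b - a) * (k + (a + b) / 2 * l) := by
  rw [intervalIntegral.integral_add intervalIntegrable_const
    (Continuous.intervalIntegrable (by fun_prop) _ _), intervalIntegral.integral_const,
    intervalIntegral.integral_mul_const, integral_id, smul_eq_mul]
  ring

/-- Continuity of `f` on $[0,T]$ identifies the one-sided limits with the nodal values. -/
lemma quadGL_eq {m : ℕ} (hf : ContinuousOn f (Icc 0 T)) (hm : m ∈ Finset.Icc 1 M.N) (w : VecL2 Ω) :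
    M.quadGL m (fun s => ⟪f s, w⟫_ℝ)
      = M.len m / 2 * (⟪f (M.t (m - 1)), w⟫_ℝ + ⟪f (M.t m), w⟫_ℝ) := by
  have hlt := M.t_pred_lt hm
  have hmN := (Finset.mem_Icc.1 hm).2
  have h0 : M.t (m - 1) ∈ Icc 0 T := M.t_mem (by omega)
  have h1 : M.t m ∈ Icc 0 T := M.t_mem hmN
  have hc : ContinuousOn (fun s => ⟪f s, w⟫_ℝ) (Icc 0 T) := hf.inner continuousOn_const
  have hr := rightLim_eq_of_tendsto (f := fun s => ⟪f s, w⟫_ℝ) (a := M.t (m - 1))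
    ((hc _ h0).mono_left (by
      rw [← nhdsWithin_Ioc_eq_nhdsGT hlt]
      exact nhdsWithin_mono _ fun s hs => ⟨h0.1.trans hs.1.le, hs.2.trans h1.2⟩))
  have hl := leftLim_eq_of_tendsto (f := fun s => ⟪f s, w⟫_ℝ) (a := M.t m)
    ((hc _ h1).mono_left (by
      rw [← nhdsWithin_Ico_eq_nhdsLT hlt]
      exact nhdsWithin_mono _ fun s hs => ⟨h0.1.trans hs.1, hs.2.le.trans h1.2⟩))
  rw [TimeMesh.quadGL, hr, hl]

namespace IsDiscreteSolution

variable {m : ℕ}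

/-- The polynomial form is given only on $(t_{m-1},t_m]$; continuity of `uh` carries it to the left
endpoint, which couples consecutive intervals. -/
lemma exists_affine (hs : IsDiscreteSolution f Vh Qh M u₀h uh ph)
    (hm : m ∈ Finset.Icc 1 M.N) :
    ∃ A ∈ Vh, ∃ B ∈ Vh, ∀ s ∈ Icc (M.t (m - 1)) (M.t m), uh s = A + s • B := by
  obtain ⟨W, hW, hu⟩ := hs.u_poly m hm
  have hlt := M.t_pred_lt hm
  have hmN := (Finset.mem_Icc.1 hm).2
  have hsub : Icc (M.t (m - 1)) (M.t m) ⊆ Icc 0 T :=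
    Icc_subset_Icc (M.t_mem (by omega)).1 (M.t_mem hmN).2
  refine ⟨W 0, hW 0, W 1, hW 1, ?_⟩
  refine EqOn.of_subset_closure (s := Ioc (M.t (m - 1)) (M.t m)) (f := uh)
    (g := fun s => W 0 + s • W 1) (fun s hsm => ?_) (hs.u_cont.mono hsub)
    (continuous_const.add (continuous_id.smul continuous_const)).continuousOn
    Ioc_subset_Icc_self (closure_Ioc hlt.ne).ge
  rw [hu s hsm, Finset.sum_range_succ, Finset.sum_range_one, pow_zero, pow_one, one_smul]

lemma mid_eq (hs : IsDiscreteSolution f Vh Qh M u₀h uh ph)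
    (hm : m ∈ Finset.Icc 1 M.N) :
    uh (M.mid m) = (1 / 2 : ℝ) • (uh (M.t (m - 1)) + uh (M.t m)) := by
  obtain ⟨A, -, B, -, h⟩ := hs.exists_affine hm
  have hlt := (M.t_pred_lt hm).le
  rw [h _ ⟨le_rfl, hlt⟩, h _ ⟨hlt, le_rfl⟩, h (M.mid m) ⟨by rw [TimeMesh.mid]; linarith,
    by rw [TimeMesh.mid]; linarith⟩, TimeMesh.mid]
  module

lemma hasDerivAt_toL2 (hs : IsDiscreteSolution f Vh Qh M u₀h uh ph)
    (hm : m ∈ Finset.Icc 1 M.N) {s : ℝ}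
    (hsm : s ∈ Ioo (M.t (m - 1)) (M.t m)) :
    HasDerivAt (fun s => (uh s).toL2)
      ((1 / M.len m) • vecToL2 (uh (M.t m) - uh (M.t (m - 1)))) s := by
  obtain ⟨A, -, B, -, h⟩ := hs.exists_affine hm
  have hlt := (M.t_pred_lt hm).le
  have e : (1 / M.len m) • vecToL2 (uh (M.t m) - uh (M.t (m - 1))) = vecToL2 B := by
    rw [h _ ⟨le_rfl, hlt⟩, h _ ⟨hlt, le_rfl⟩, ← map_smul]
    congr 1
    have h1 : A + M.t m • B - (A + M.t (m - 1) • B) = M.len m • B := by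
      rw [TimeMesh.len]; module
    rw [h1, smul_smul, one_div_mul_cancel (M.len_pos hm).ne', one_smul]
  rw [e]
  have h1 : HasDerivAt (fun s : ℝ => vecToL2 A + s • vecToL2 B) ((1 : ℝ) • vecToL2 B) s :=
    ((hasDerivAt_id s).smul_const (vecToL2 B)).const_add (vecToL2 A)
  rw [one_smul] at h1
  refine h1.congr_of_eventuallyEq ?_
  filter_upwards [Ioo_mem_nhds hsm.1 hsm.2] with x hx
  change vecToL2 (uh x) = _
  rw [h x ⟨hx.1.le, hx.2.le⟩, map_add, map_smul]

/-- For an affine function the integral over $I_m$ is $\tau_m$ times the average of the nodal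
values. So if $b(u_{\tau,h},q)$ vanishes at $t_{m-1}$ and has zero integral, it vanishes at $t_m$;
the induction starts from `initial_mem`. -/
lemma mem_discreteDivFree (hs : IsDiscreteSolution f Vh Qh M u₀h uh ph)
    (hm : m ≤ M.N) : uh (M.t m) ∈ discreteDivFreeSubmodule Vh Qh := by
  induction m with
  | zero =>
    rw [M.t_zero, hs.initial]
    exact hs.initial_mem
  | succ k ih =>
    have hk := ih (by omega)
    have hm' : k + 1 ∈ Finset.Icc 1 M.N := Finset.mem_Icc.2 ⟨by omega, hm⟩
    obtain ⟨A, hA, B, hB, h⟩ := hs.exists_affine hm'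
    have hlt := M.t_pred_lt hm'
    rw [Nat.add_sub_cancel] at h hlt
    refine ⟨?_, fun q hq => ?_⟩
    · rw [h _ ⟨hlt.le, le_rfl⟩]
      exact Vh.add_mem hA (Vh.smul_mem _ hB)
    · have h1 := hs.div_free (k + 1) hm' (fun _ => q) (isPolyOn_zero_const hq _)
      rw [Nat.add_sub_cancel] at h1
      have h2 : ∫ s in M.t k..M.t (k + 1), bForm (uh s) q
          = ∫ s in M.t k..M.t (k + 1), (bForm A q + s * bForm B q) := by
        refine intervalIntegral.integral_congr_Ioo_of_le hlt.le fun s hsm => ?_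
        rw [h s ⟨hsm.1.le, hsm.2.le⟩, bForm_eq_inner, bForm_eq_inner, bForm_eq_inner, map_add,
          map_smul, inner_add_left, real_inner_smul_left]
      rw [h2, integral_affine, mul_eq_zero, or_iff_right (sub_pos.2 hlt).ne'] at h1
      have h3 := hk.2 q hq
      rw [h _ ⟨le_rfl, hlt.le⟩, bForm_eq_inner, map_add, map_smul, inner_add_left,
        real_inner_smul_left] at h3
      rw [h _ ⟨hlt.le, le_rfl⟩, bForm_eq_inner, map_add, map_smul, inner_add_left,
        real_inner_smul_left]
      rw [bForm_eq_inner, bForm_eq_inner] at h1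
      linarith

/-- The scheme, tested with discretely divergence-free functions, is the Crank-Nicolson scheme. -/
lemma crankNicolson (hs : IsDiscreteSolution f Vh Qh M u₀h uh ph)
    (hf : ContinuousOn f (Icc 0 T)) (hm : m ∈ Finset.Icc 1 M.N)
    {w : VecSobolev 1 Ω} (hw : w ∈ discreteDivFree Vh Qh) :
    ⟪vecToL2 (uh (M.t m) - uh (M.t (m - 1))), vecToL2 w⟫_ℝ
      + M.len m * ⟪grad ((1 / 2 : ℝ) • (uh (M.t (m - 1)) + uh (M.t m))), grad w⟫_ℝ
      = M.len m / 2 * (⟪f (M.t (m - 1)), vecToL2 w⟫_ℝ + ⟪f (M.t m), vecToL2 w⟫_ℝ) := by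
  have hlt := M.t_pred_lt hm
  have hmom := hs.momentum m hm (fun _ => w) (isPolyOn_zero_const hw.1 _)
  have hq := quadGL_eq hf hm (vecToL2 w)
  rw [← hq]
  refine Eq.trans ?_ hmom
  obtain ⟨A, hA, B, hB, h⟩ := hs.exists_affine hm
  obtain ⟨P, hP, hph⟩ := hs.p_poly m hm
  obtain ⟨c, hc⟩ : ∃ c, c = (1 / M.len m) • vecToL2 (uh (M.t m) - uh (M.t (m - 1))) := ⟨_, rfl⟩
  have h2 : ∫ s in (M.t (m - 1))..(M.t m),
        (⟪deriv (fun s' => (uh s').toL2) s, w.toL2⟫_ℝ + aForm (uh s) w + bForm w (ph s))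
      = ∫ s in (M.t (m - 1))..(M.t m),
        (⟪c, vecToL2 w⟫_ℝ + ⟪grad A, grad w⟫_ℝ + s * ⟪grad B, grad w⟫_ℝ) := by
    refine intervalIntegral.integral_congr_Ioo_of_le hlt.le fun s hsm => ?_
    have hb : bForm w (ph s) = 0 := by
      refine hw.2 _ ?_
      rw [hph s ⟨hsm.1, hsm.2.le⟩]
      exact Qh.sum_mem fun j _ => Qh.smul_mem _ (hP j)
    change ⟪deriv (fun s' => (uh s').toL2) s, w.toL2⟫_ℝ + aForm (uh s) w + bForm w (ph s)
      = ⟪c, vecToL2 w⟫_ℝ + ⟪grad A, grad w⟫_ℝ + s * ⟪grad B, grad w⟫_ℝ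
    rw [(hs.hasDerivAt_toL2 hm hsm).deriv, ← hc, hb, aForm_eq_inner_grad, h s ⟨hsm.1.le, hsm.2.le⟩,
      map_add, map_smul, inner_add_left, real_inner_smul_left, add_zero, ← add_assoc]
    rfl
  rw [h2, integral_affine, h _ ⟨le_rfl, hlt.le⟩, h _ ⟨hlt.le, le_rfl⟩]
  have e1 : ⟪vecToL2 (A + M.t m • B - (A + M.t (m - 1) • B)), vecToL2 w⟫_ℝ
      = M.len m * ⟪c, vecToL2 w⟫_ℝ := by
    rw [hc, real_inner_smul_left, ← mul_assoc, mul_one_div_cancel (M.len_pos hm).ne', one_mul,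
      h _ ⟨le_rfl, hlt.le⟩, h _ ⟨hlt.le, le_rfl⟩]
  rw [e1, map_smul, map_add, map_add, map_add, map_smul, map_smul, real_inner_smul_left,
    inner_add_left, inner_add_left, inner_add_left, real_inner_smul_left, real_inner_smul_left,
    TimeMesh.len]
  ring

end IsDiscreteSolution

end DiscreteSolution

/-! ### Summation of the one-step estimates over the mesh. -/

section SequenceStability

open scoped InnerProductSpace

variable {X H Y : Type*} [AddCommGroup X] [Module ℝ X]
  [NormedAddCommGroup H] [InnerProductSpace ℝ H] [NormedAddCommGroup Y] [InnerProductSpace ℝ Y]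
  {J : X →ₗ[ℝ] H} {G : X →ₗ[ℝ] Y} {W : Submodule ℝ X} {ξ : ℕ → X} {ρ : ℕ → H} {τ : ℕ → ℝ}
  {n : ℕ} {T K cP : ℝ}

/-- The one-step bounds telescope with factor one, so the residuals contribute at most
$\sum\tau_mK^2\le TK^2$, without exponential growth. -/
lemma crankNicolson_stability_strong (hξ : ∀ m ≤ n, ξ m ∈ W)
    (hτ : ∀ m ∈ Finset.Icc 1 n, 0 < τ m) (hT : ∑ m ∈ Finset.Icc 1 n, τ m ≤ T)
    (hρ : ∀ m ∈ Finset.Icc 1 n, ‖ρ m‖ ≤ τ m * K)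
    (h : ∀ m ∈ Finset.Icc 1 n, ∀ w ∈ W, ⟪J (ξ m - ξ (m - 1)), J w⟫_ℝ
      + τ m * ⟪G ((1 / 2 : ℝ) • (ξ (m - 1) + ξ m)), G w⟫_ℝ = ⟪ρ m, J w⟫_ℝ) :
    ∑ m ∈ Finset.Icc 1 n, τ m * ‖(1 / τ m) • J (ξ m - ξ (m - 1))‖ ^ 2 + ‖G (ξ n)‖ ^ 2
      ≤ ‖G (ξ 0)‖ ^ 2 + T * K ^ 2 := by
  refine (sum_add_le_of_step (a := fun m => τ m * ‖(1 / τ m) • J (ξ m - ξ (m - 1))‖ ^ 2)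
    (E := fun m => ‖G (ξ m)‖ ^ 2) (τ := τ) (K := K ^ 2) fun m hm => ?_).trans
    (add_le_add_right (mul_le_mul_of_nonneg_right hT (sq_nonneg K)) _)
  have hm' := Finset.mem_Icc.1 hm
  exact crankNicolson_step_strong J G (hτ m hm) (hρ m hm)
    (h m hm _ (W.sub_mem (hξ m hm'.2) (hξ (m - 1) (by omega))))

lemma crankNicolson_stability_weak (hξ : ∀ m ≤ n, ξ m ∈ W)
    (hτ : ∀ m ∈ Finset.Icc 1 n, 0 < τ m) (hT : ∑ m ∈ Finset.Icc 1 n, τ m ≤ T) (hK : 0 ≤ K)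
    (hρ : ∀ m ∈ Finset.Icc 1 n, ‖ρ m‖ ≤ τ m * K) (hP : ∀ w ∈ W, ‖J w‖ ≤ cP * ‖G w‖)
    (h : ∀ m ∈ Finset.Icc 1 n, ∀ w ∈ W, ⟪J (ξ m - ξ (m - 1)), J w⟫_ℝ
      + τ m * ⟪G ((1 / 2 : ℝ) • (ξ (m - 1) + ξ m)), G w⟫_ℝ = ⟪ρ m, J w⟫_ℝ) :
    ∑ m ∈ Finset.Icc 1 n, τ m * ‖G ((1 / 2 : ℝ) • (ξ (m - 1) + ξ m))‖ ^ 2 + ‖J (ξ n)‖ ^ 2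
      ≤ ‖J (ξ 0)‖ ^ 2 + T * (cP * K) ^ 2 := by
  refine (sum_add_le_of_step (a := fun m => τ m * ‖G ((1 / 2 : ℝ) • (ξ (m - 1) + ξ m))‖ ^ 2)
    (E := fun m => ‖J (ξ m)‖ ^ 2) (τ := τ) (K := (cP * K) ^ 2) fun m hm => ?_).trans
    (add_le_add_right (mul_le_mul_of_nonneg_right hT (sq_nonneg _)) _)
  have hm' := Finset.mem_Icc.1 hm
  have hw : (1 / 2 : ℝ) • (ξ (m - 1) + ξ m) ∈ W :=
    W.smul_mem _ (W.add_mem (hξ (m - 1) (by omega)) (hξ m hm'.2))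
  rw [add_comm]
  exact crankNicolson_step_weak J G (hτ m hm) (hρ m hm) (hP _ hw) hK (h m hm _ hw)

/-- A perturbation of the weighted square sum and of the final value. -/
lemma sum_sq_add_sq_le_of_perturbation {x y : ℕ → ℝ} {a b D E R : ℝ}
    (hτ : ∀ m ∈ Finset.Icc 1 n, 0 < τ m) (hT : ∑ m ∈ Finset.Icc 1 n, τ m ≤ T)
    (hy : ∀ m ∈ Finset.Icc 1 n, 0 ≤ y m ∧ y m ≤ x m + D) (hb : 0 ≤ b ∧ b ≤ a + E)
    (h : ∑ m ∈ Finset.Icc 1 n, τ m * x m ^ 2 + a ^ 2 ≤ R) :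
    ∑ m ∈ Finset.Icc 1 n, τ m * y m ^ 2 + b ^ 2 ≤ 2 * R + 2 * (T * D ^ 2) + 2 * E ^ 2 := by
  have h1 : ∀ m ∈ Finset.Icc 1 n, τ m * y m ^ 2 ≤ 2 * (τ m * x m ^ 2) + τ m * (2 * D ^ 2) :=
    fun m hm => by
      have := pow_le_pow_left₀ (hy m hm).1 (hy m hm).2 2
      have h2 := mul_le_mul_of_nonneg_left
        (this.trans (add_sq_le (a := x m) (b := D))) (hτ m hm).le
      linarith
  have h2 := Finset.sum_le_sum h1
  rw [Finset.sum_add_distrib, ← Finset.mul_sum, ← Finset.sum_mul] at h2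
  have h3 := mul_le_mul_of_nonneg_right hT (by positivity : 0 ≤ 2 * D ^ 2)
  have h4 := (pow_le_pow_left₀ hb.1 hb.2 2).trans (add_sq_le (a := a) (b := E))
  linarith

end SequenceStability

/-! ### Bounds from the regularity of the solution, and the error equation. -/

section RegularSolution

open scoped InnerProductSpace

variable {d : ℕ} {Ω : Opens (Pt d)} {T : ℝ} {r : ℕ} {hr : 1 ≤ r}
  {f : ℝ → VecL2 Ω} {u₀ : VecL2 Ω} {u : ℝ → VecSobolev (r + 1) Ω} {p : ℝ → Sobolev r Ω}

/-- `u` as a curve in `H^1(Ω)^d`. -/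
abbrev toH1 (u : ℝ → VecSobolev (r + 1) Ω) (t : ℝ) : VecSobolev 1 Ω :=
  (u t).incl (Nat.le_add_left 1 r)

/-- `∂_t u` as a curve in `L²(Ω)^d`. -/
abbrev timeDeriv (T : ℝ) (u : ℝ → VecSobolev (r + 1) Ω) (t : ℝ) : VecL2 Ω :=
  derivWithin (fun s => (u s).toL2) (Icc 0 T) t

/-- The consequences of the regularity of the solution that enter the error estimate. -/
structure HasRegularityBound (T : ℝ) (u : ℝ → VecSobolev (r + 1) Ω) (p : ℝ → Sobolev r Ω)
    (K : ℝ) : Prop where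
  nonneg : 0 ≤ K
  bound : ∀ t ∈ Icc 0 T, ‖u t‖ + ‖p t‖ ≤ K
  lipschitz : ∀ a ∈ Icc 0 T, ∀ b ∈ Icc 0 T, a ≤ b → ‖u b - u a‖ + ‖p b - p a‖ ≤ K * (b - a)
  trapezoid : ∀ a ∈ Icc 0 T, ∀ b ∈ Icc 0 T, a ≤ b →
    ‖vecToL2 (toH1 u b - toH1 u a) - ((b - a) / 2) • (timeDeriv T u a + timeDeriv T u b)‖
      ≤ K * (b - a) ^ 3
  average_deriv : ∀ a ∈ Icc 0 T, ∀ b ∈ Icc 0 T, a ≤ b →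
    ‖timeDeriv T u ((a + b) / 2) - (1 / 2 : ℝ) • (timeDeriv T u a + timeDeriv T u b)‖
      ≤ K * (b - a) ^ 2
  average : ∀ a ∈ Icc 0 T, ∀ b ∈ Icc 0 T, a ≤ b →
    ‖toH1 u ((a + b) / 2) - (1 / 2 : ℝ) • (toH1 u a + toH1 u b)‖ ≤ K * (b - a) ^ 2

/-- The size and Lipschitz bounds use $C^1$ in $H^{r+1}$ and $H^r$, the bounds on $\partial_tu$ use
$C^3$ in $L^2$, and the midpoint average uses $C^2$ in $H^1$. Summing all the constants gives a
single `K` that does not depend on the discretization. -/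
lemma IsRegularStokesSolution.exists_regularityBound
    (hu : IsRegularStokesSolution Ω T r hr f u₀ u p) (hT : 0 < T) :
    ∃ K, HasRegularityBound T u p K := by
  obtain ⟨K₁, h1⟩ := isCompact_Icc.exists_bound_of_continuousOn hu.u_reg.continuousOn
  obtain ⟨K₂, h2⟩ := isCompact_Icc.exists_bound_of_continuousOn hu.p_reg.continuousOn
  obtain ⟨K₃, h30, h3⟩ := exists_lipschitz_of_contDiffOn_Icc hT hu.u_reg
  obtain ⟨K₄, h40, h4⟩ := exists_lipschitz_of_contDiffOn_Icc hT hu.p_reg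
  obtain ⟨K₅, h50, h5⟩ := exists_trapezoid_error_bound hT hu.u_reg_L2
  obtain ⟨K₆, h60, h6⟩ := exists_average_error_bound hT
    (hu.u_reg_L2.derivWithin (m := 2) (uniqueDiffOn_Icc hT) (by norm_num))
  obtain ⟨K₇, h70, h7⟩ := exists_average_error_bound hT hu.u_reg_H1
  have h10 : 0 ≤ K₁ := (norm_nonneg _).trans (h1 0 ⟨le_rfl, hT.le⟩)
  have h20 : 0 ≤ K₂ := (norm_nonneg _).trans (h2 0 ⟨le_rfl, hT.le⟩)
  refine ⟨K₁ + K₂ + K₃ + K₄ + K₅ + K₆ + K₇, by positivity, fun t ht => ?_, fun a ha b hb hab => ?_,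
    fun a ha b hb hab => ?_, fun a ha b hb hab => ?_, fun a ha b hb hab => ?_⟩
  · linarith [h1 t ht, h2 t ht]
  · have e3 := h3 b hb a ha
    have e4 := h4 b hb a ha
    rw [abs_of_nonneg (sub_nonneg.2 hab)] at e3 e4
    have := mul_nonneg (by positivity : 0 ≤ K₁ + K₂ + K₅ + K₆ + K₇) (sub_nonneg.2 hab)
    linarith
  · refine (h5 a ha b hb hab).trans (mul_le_mul_of_nonneg_right (by linarith) ?_)
    exact pow_nonneg (sub_nonneg.2 hab) 3
  · exact (h6 a ha b hb hab).trans (mul_le_mul_of_nonneg_right (by linarith) (sq_nonneg _))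
  · exact (h7 a ha b hb hab).trans (mul_le_mul_of_nonneg_right (by linarith) (sq_nonneg _))

/-- Boundedness of $\Omega$ gives $L^2\subset L^1$, without which the integral of a difference could
not be split. -/
lemma sub_mem_pressureSpace (hΩ : Bornology.IsBounded (Ω : Set (Pt d))) {q q' : L2 Ω}
    (hq : q ∈ pressureSpace Ω) (hq' : q' ∈ pressureSpace Ω) : q - q' ∈ pressureSpace Ω := by
  have : IsFiniteMeasure (volume.restrict (Ω : Set (Pt d))) :=
    ⟨by rw [Measure.restrict_apply_univ]; exact hΩ.measure_lt_top⟩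
  change ∫ x in (Ω : Set (Pt d)), (q - q') x = 0
  have hi : ∀ g : L2 Ω, Integrable g (volume.restrict (Ω : Set (Pt d))) := fun g =>
    (Lp.memLp g).integrable (by norm_num)
  rw [integral_congr_ae (Lp.coeFn_sub q q')]
  simp only [Pi.sub_apply]
  rw [integral_sub (hi q) (hi q'), hq, hq', sub_zero]

/-- `θ(t)` is the Stokes projection of `(u(t), p(t))` onto `V_h^div`, with error bound `A`. -/
structure IsStokesProjection (T : ℝ) (u : ℝ → VecSobolev (r + 1) Ω) (p : ℝ → Sobolev r Ω)
    (Vh : Submodule ℝ (VecSobolev 1 Ω)) (Qh : Submodule ℝ (L2 Ω)) (θ : ℝ → VecSobolev 1 Ω)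
    (A : ℝ) : Prop where
  mem : ∀ t, θ t ∈ discreteDivFreeSubmodule Vh Qh
  eq : ∀ t, ∀ w ∈ discreteDivFreeSubmodule Vh Qh,
    ⟪grad (θ t), grad w⟫_ℝ = ⟪grad (toH1 u t), grad w⟫_ℝ + bForm w (p t).toL2
  bound : ∀ t ∈ Icc 0 T, ‖grad (toH1 u t - θ t)‖ ≤ A
  lipschitz : ∀ a ∈ Icc 0 T, ∀ b ∈ Icc 0 T, a ≤ b →
    ‖grad ((toH1 u b - θ b) - (toH1 u a - θ a))‖ ≤ A * (b - a)

/-- The defining equations are linear in $(u,p)$, so $\theta(b)-\theta(a)$ is a projection of the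
increments of $u$ and $p$, and the same error bound applies to it. Hence $\theta$ may be chosen
separately at each time, and its differentiability is never needed. -/
lemma IsFEPair.exists_isStokesProjection {β cA h K : ℝ} {Vh : Submodule ℝ (VecSobolev 1 Ω)}
    {Qh : Submodule ℝ (L2 Ω)} (hFE : IsFEPair Ω r β cA h Vh Qh) (hβ : 0 < β)
    (hΩ : Bornology.IsBounded (Ω : Set (Pt d)))
    (hu : IsRegularStokesSolution Ω T r hr f u₀ u p) (hT : 0 < T)
    (hK : HasRegularityBound T u p K) :
    ∃ θ, IsStokesProjection T u p Vh Qh θ ((2 * (1 + d * d / β) + d) * |cA| * K * h ^ r) := by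
  have := hFE.finite_V
  have hle : discreteDivFreeSubmodule Vh Qh ≤ Vh := fun w hw => hw.1
  have : FiniteDimensional ℝ (discreteDivFreeSubmodule Vh Qh) :=
    Submodule.finiteDimensional_of_le hle
  have hh := hFE.h_pos
  choose θ hθ hθ' using fun t =>
    exists_stokes_projection (discreteDivFreeSubmodule Vh Qh) (toH1 u t) (p t).toL2
  have hc : 0 ≤ (2 * (1 + d * d / β) + d) * |cA| * h ^ r := by positivity
  refine ⟨θ, hθ, hθ', fun t ht => ?_, fun a ha b hb hab => ?_⟩
  · refine (hFE.norm_grad_sub_stokes_projection_le hβ (hu.boundary t ht)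
      (hu.divergence_eq_zero hT ht) (hu.mean_zero t ht) (hθ t) (hθ' t)).trans ?_
    calc _ ≤ (2 * (1 + d * d / β) + d) * |cA| * h ^ r * K :=
          mul_le_mul_of_nonneg_left (hK.bound t ht) hc
      _ = _ := by ring
  · have e : (u b - u a).incl (Nat.le_add_left 1 r) = toH1 u b - toH1 u a := rfl
    have h1 := hFE.norm_grad_sub_stokes_projection_le hβ (v := u b - u a) (q := p b - p a)
      (θ := θ b - θ a) ((velocitySpace Ω).sub_mem (hu.boundary b hb) (hu.boundary a ha))
      (by rw [e, map_sub, hu.divergence_eq_zero hT hb, hu.divergence_eq_zero hT ha, sub_zero])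
      (sub_mem_pressureSpace hΩ (hu.mean_zero b hb) (hu.mean_zero a ha))
      ((discreteDivFreeSubmodule Vh Qh).sub_mem (hθ b) (hθ a)) (fun w hw => by
        have e2 : (p b - p a).toL2 = (p b).toL2 - (p a).toL2 := rfl
        have h2 := hθ' b w hw
        have h3 := hθ' a w hw
        rw [bForm_eq_inner] at h2 h3
        rw [e, e2, map_sub, map_sub, inner_sub_left, inner_sub_left, bForm_eq_inner,
          inner_sub_right, h2, h3]
        ring)
    have e3 : (toH1 u b - θ b) - (toH1 u a - θ a)
        = (u b - u a).incl (Nat.le_add_left 1 r) - (θ b - θ a) := by rw [e]; abel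
    rw [e3]
    refine h1.trans ?_
    calc _ ≤ (2 * (1 + d * d / β) + d) * |cA| * h ^ r * (K * (b - a)) :=
          mul_le_mul_of_nonneg_left (hK.lipschitz a ha b hb hab) hc
      _ = _ := by ring

section ErrorEstimate

variable {Vh : Submodule ℝ (VecSobolev 1 Ω)} {Qh : Submodule ℝ (L2 Ω)} {M : TimeMesh T}
  {u₀h : VecSobolev 1 Ω} {uh θ : ℝ → VecSobolev 1 Ω} {ph : ℝ → L2 Ω} {A K cP : ℝ} {m n : ℕ}

/-- The error equation for `θ - u_{τ,h}`, where `θ` is the Stokes projection of the solution. -/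
lemma IsDiscreteSolution.error_equation (hs : IsDiscreteSolution f Vh Qh M u₀h uh ph)
    (hu : IsRegularStokesSolution Ω T r hr f u₀ u p) (hT : 0 < T) (hV : Vh ≤ velocitySpace Ω)
    (hθ : IsStokesProjection T u p Vh Qh θ A) (hm : m ∈ Finset.Icc 1 M.N)
    {w : VecSobolev 1 Ω} (hw : w ∈ discreteDivFreeSubmodule Vh Qh) :
    ⟪vecToL2 ((θ (M.t m) - uh (M.t m)) - (θ (M.t (m - 1)) - uh (M.t (m - 1)))), vecToL2 w⟫_ℝ
      + M.len m * ⟪grad ((1 / 2 : ℝ) • ((θ (M.t (m - 1)) - uh (M.t (m - 1)))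
        + (θ (M.t m) - uh (M.t m)))), grad w⟫_ℝ
      = ⟪vecToL2 (θ (M.t m) - θ (M.t (m - 1)))
        - (M.len m / 2) • (timeDeriv T u (M.t (m - 1)) + timeDeriv T u (M.t m)), vecToL2 w⟫_ℝ := by
  have hm' := Finset.mem_Icc.1 hm
  have hcn := hs.crankNicolson hu.f_cont hm hw
  have h1 := hu.weak_momentum hT (M.t_mem (m := m - 1) (by omega)) (hV hw.1)
  have h2 := hu.weak_momentum hT (M.t_mem hm'.2) (hV hw.1)
  have h3 := hθ.eq (M.t (m - 1)) w hw
  have h4 := hθ.eq (M.t m) w hw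
  rw [← h1, ← h2] at hcn
  simp only [map_sub, map_add, map_smul, inner_add_left, inner_sub_left, real_inner_smul_left]
    at hcn ⊢
  -- The scheme is subtracted from the average of the weak momentum equations at the two nodes; `h3`
  -- and `h4` replace $u$ by $\theta$ and cancel the pressure.
  linear_combination (-1 : ℝ) * hcn + (M.len m / 2) * (h3 + h4)

/-- The residual is the trapezoidal error of $u$ minus the increment of $u-\theta$; Poincaré's
inequality carries the Lipschitz bound on the latter from gradients to $L^2$. -/
lemma IsStokesProjection.norm_residual_le (hθ : IsStokesProjection T u p Vh Qh θ A)
    (hK : HasRegularityBound T u p K) (hV : Vh ≤ velocitySpace Ω)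
    (hu : IsRegularStokesSolution Ω T r hr f u₀ u p) (hcP : 0 ≤ cP)
    (hP : ∀ v ∈ velocitySpace Ω, ‖vecToL2 v‖ ≤ cP * ‖grad v‖) {a b : ℝ} (ha : a ∈ Icc 0 T)
    (hb : b ∈ Icc 0 T) (hab : a ≤ b) :
    ‖vecToL2 ((toH1 u b - θ b) - (toH1 u a - θ a))‖ ≤ (b - a) * (cP * A) ∧
    ‖vecToL2 (θ b - θ a) - ((b - a) / 2) • (timeDeriv T u a + timeDeriv T u b)‖
      ≤ (b - a) * (cP * A + K * (b - a) ^ 2) := by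
  have hmem : ∀ t ∈ Icc 0 T, toH1 u t - θ t ∈ velocitySpace Ω := fun t ht =>
    (velocitySpace Ω).sub_mem (hu.boundary t ht) (hV (hθ.mem t).1)
  have h1 : ‖vecToL2 ((toH1 u b - θ b) - (toH1 u a - θ a))‖ ≤ (b - a) * (cP * A) := by
    refine (hP _ ((velocitySpace Ω).sub_mem (hmem b hb) (hmem a ha))).trans ?_
    calc _ ≤ cP * (A * (b - a)) := mul_le_mul_of_nonneg_left (hθ.lipschitz a ha b hb hab) hcP
      _ = _ := by ring
  refine ⟨h1, ?_⟩
  have e : vecToL2 (θ b - θ a) - ((b - a) / 2) • (timeDeriv T u a + timeDeriv T u b)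
      = (vecToL2 (toH1 u b - toH1 u a) - ((b - a) / 2) • (timeDeriv T u a + timeDeriv T u b))
        - vecToL2 ((toH1 u b - θ b) - (toH1 u a - θ a)) := by
    simp only [map_sub]; abel
  rw [e]
  refine (norm_sub_le _ _).trans ?_
  have h2 := hK.trapezoid a ha b hb hab
  linarith

/-- The consistency error of the difference quotient at the midpoint. -/
lemma HasRegularityBound.norm_timeDeriv_sub_le (hK : HasRegularityBound T u p K) {a b : ℝ}
    (ha : a ∈ Icc 0 T) (hb : b ∈ Icc 0 T) (hab : a < b) :
    ‖timeDeriv T u ((a + b) / 2) - (1 / (b - a)) • vecToL2 (toH1 u b - toH1 u a)‖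
      ≤ 2 * K * (b - a) ^ 2 := by
  have h0 : 0 < b - a := sub_pos.2 hab
  have h1 := hK.average_deriv a ha b hb hab.le
  have h2 := hK.trapezoid a ha b hb hab.le
  have e : timeDeriv T u ((a + b) / 2) - (1 / (b - a)) • vecToL2 (toH1 u b - toH1 u a)
      = (timeDeriv T u ((a + b) / 2) - (1 / 2 : ℝ) • (timeDeriv T u a + timeDeriv T u b))
        - (1 / (b - a)) • (vecToL2 (toH1 u b - toH1 u a)
          - ((b - a) / 2) • (timeDeriv T u a + timeDeriv T u b)) := by
    rw [smul_sub, smul_smul, show 1 / (b - a) * ((b - a) / 2) = 1 / 2 by field_simp]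
    abel
  rw [e]
  refine (norm_sub_le _ _).trans ?_
  have h3 : ‖(1 / (b - a)) • (vecToL2 (toH1 u b - toH1 u a)
      - ((b - a) / 2) • (timeDeriv T u a + timeDeriv T u b))‖ ≤ K * (b - a) ^ 2 := by
    rw [norm_smul, Real.norm_of_nonneg (by positivity)]
    calc _ ≤ 1 / (b - a) * (K * (b - a) ^ 3) := by gcongr
      _ = _ := by field_simp
  linarith

/-- The midpoint is interior both to $[0,T]$ and to $I_m$, so the one-sided derivative of $u$ is a
true derivative and `uh` is affine nearby. -/
lemma hasDerivAt_velocityError (hs : IsDiscreteSolution f Vh Qh M u₀h uh ph)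
    (hu : IsRegularStokesSolution Ω T r hr f u₀ u p) (hm : m ∈ Finset.Icc 1 M.N) :
    HasDerivAt (fun s => (velocityError u uh s).toL2)
      (timeDeriv T u (M.mid m)
        - (1 / M.len m) • vecToL2 (uh (M.t m) - uh (M.t (m - 1)))) (M.mid m) := by
  have hm' := Finset.mem_Icc.1 hm
  have hlt := M.t_pred_lt hm
  have hmid : M.mid m ∈ Ioo (M.t (m - 1)) (M.t m) :=
    ⟨by rw [TimeMesh.mid]; linarith, by rw [TimeMesh.mid]; linarith⟩
  have h0 := (M.t_mem (m := m - 1) (by omega)).1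
  have h1 := (M.t_mem hm'.2).2
  have hmem : M.mid m ∈ Icc 0 T := ⟨h0.trans hmid.1.le, hmid.2.le.trans h1⟩
  have hd : HasDerivAt (fun s => (u s).toL2) (timeDeriv T u (M.mid m)) (M.mid m) :=
    ((hu.u_reg_L2.differentiableOn (by simp) _ hmem).hasDerivWithinAt).hasDerivAt
      (Icc_mem_nhds (h0.trans_lt hmid.1) (hmid.2.trans_le h1))
  exact hd.sub (hs.hasDerivAt_toL2 hm hmid)

end ErrorEstimate


end RegularSolution

/-! ### The two error bounds in terms of the projection error `A` and the mesh size. -/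

section ErrorBounds

open scoped InnerProductSpace

variable {d : ℕ} {Ω : Opens (Pt d)} {T : ℝ} {r : ℕ} {hr : 1 ≤ r}
  {f : ℝ → VecL2 Ω} {u₀ : VecL2 Ω} {u : ℝ → VecSobolev (r + 1) Ω} {p : ℝ → Sobolev r Ω}
  {Vh : Submodule ℝ (VecSobolev 1 Ω)} {Qh : Submodule ℝ (L2 Ω)} {M : TimeMesh T}
  {u₀h : VecSobolev 1 Ω} {uh θ : ℝ → VecSobolev 1 Ω} {ph : ℝ → L2 Ω} {A K cP : ℝ} {n : ℕ}

/-- The factor 2 is slack: it makes the bound coincide with the midpoint defect in `error_strong`,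
where the consistency error is $2K\tau^2$. -/
lemma TimeMesh.len_mul_residual_le (hK : 0 ≤ K) {m : ℕ} {x : ℝ}
    (hm : m ∈ Finset.Icc 1 M.N) (hx : x ≤ M.len m * (cP * A + K * M.len m ^ 2)) :
    x ≤ M.len m * (cP * A + 2 * K * M.size ^ 2) := by
  have h0 := M.len_pos hm
  have h1 := pow_le_pow_left₀ h0.le (M.len_le_size hm) 2
  refine hx.trans (mul_le_mul_of_nonneg_left ?_ h0.le)
  nlinarith [sq_nonneg (M.len m)]

/-- Error of the time derivative at the midpoints and of the gradient at the mesh points. -/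
lemma IsDiscreteSolution.error_strong (hs : IsDiscreteSolution f Vh Qh M u₀h uh ph)
    (hu : IsRegularStokesSolution Ω T r hr f u₀ u p) (hT : 0 < T) (hV : Vh ≤ velocitySpace Ω)
    (hθ : IsStokesProjection T u p Vh Qh θ A) (hK : HasRegularityBound T u p K)
    (hcP : 0 ≤ cP) (hP : ∀ v ∈ velocitySpace Ω, ‖vecToL2 v‖ ≤ cP * ‖grad v‖) (hn : n ≤ M.N) :
    ∑ m ∈ Finset.Icc 1 n,
        M.len m * ‖deriv (fun s => (velocityError u uh s).toL2) (M.mid m)‖ ^ 2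
        + ‖grad (velocityError u uh (M.t n))‖ ^ 2
      ≤ 2 * (2 * ‖grad (velocityError u uh 0)‖ ^ 2 + 2 * A ^ 2
          + T * (cP * A + 2 * K * M.size ^ 2) ^ 2)
        + 2 * (T * (cP * A + 2 * K * M.size ^ 2) ^ 2) + 2 * A ^ 2 := by
  have hsub : ∀ m ∈ Finset.Icc 1 n, m ∈ Finset.Icc 1 M.N := fun m hm =>
    Finset.Icc_subset_Icc_right hn hm
  have hmem : ∀ m ∈ Finset.Icc 1 n, M.t (m - 1) ∈ Icc 0 T ∧ M.t m ∈ Icc 0 T := fun m hm => by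
    have := Finset.mem_Icc.1 (hsub m hm)
    exact ⟨M.t_mem (by omega), M.t_mem this.2⟩
  have hstab := crankNicolson_stability_strong (J := vecToL2) (G := grad)
    (W := discreteDivFreeSubmodule Vh Qh) (ξ := fun m => θ (M.t m) - uh (M.t m))
    (ρ := fun m => vecToL2 (θ (M.t m) - θ (M.t (m - 1)))
        - (M.len m / 2) • (timeDeriv T u (M.t (m - 1)) + timeDeriv T u (M.t m)))
    (τ := M.len) (n := n) (T := T) (K := cP * A + 2 * K * M.size ^ 2)
    (fun m hm => Submodule.sub_mem _ (hθ.mem _) (hs.mem_discreteDivFree (hm.trans hn)))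
    (fun m hm => M.len_pos (hsub m hm)) (M.sum_len_le hn)
    (fun m hm => TimeMesh.len_mul_residual_le hK.nonneg (hsub m hm)
      (hθ.norm_residual_le hK hV hu hcP hP (hmem m hm).1 (hmem m hm).2
        (M.t_pred_lt (hsub m hm)).le).2)
    (fun m hm w hw => hs.error_equation hu hT hV hθ (hsub m hm) hw)
  have h0 : M.t 0 = 0 := M.t_zero
  have hξ0 : ‖grad (θ (M.t 0) - uh (M.t 0))‖ ^ 2
      ≤ 2 * ‖grad (velocityError u uh 0)‖ ^ 2 + 2 * A ^ 2 := by
    rw [h0]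
    have e : grad (θ 0 - uh 0) = grad (velocityError u uh 0) - grad (toH1 u 0 - θ 0) := by
      rw [← map_sub]; congr 1; rw [velocityError]; abel
    have h1 : ‖grad (θ 0 - uh 0)‖ ≤ ‖grad (velocityError u uh 0)‖ + A := by
      rw [e]
      exact (norm_sub_le _ _).trans (add_le_add_right (hθ.bound 0 ⟨le_rfl, hT.le⟩) _)
    have := (pow_le_pow_left₀ (norm_nonneg _) h1 2).trans add_sq_le
    linarith
  refine sum_sq_add_sq_le_of_perturbation
    (x := fun m => ‖(1 / M.len m) • vecToL2 ((θ (M.t m) - uh (M.t m))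
      - (θ (M.t (m - 1)) - uh (M.t (m - 1))))‖)
    (y := fun m => ‖deriv (fun s => (velocityError u uh s).toL2) (M.mid m)‖)
    (a := ‖grad (θ (M.t n) - uh (M.t n))‖)
    (fun m hm => M.len_pos (hsub m hm)) (M.sum_len_le hn) (fun m hm => ⟨norm_nonneg _, ?_⟩)
    ⟨norm_nonneg _, ?_⟩ (hstab.trans (add_le_add_left hξ0 _))
  · have hm' := hsub m hm
    have hlen := M.len_pos hm'
    rw [(hasDerivAt_velocityError hs hu hm').deriv]
    have h1 := hK.norm_timeDeriv_sub_le (hmem m hm).1 (hmem m hm).2 (M.t_pred_lt hm')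
    have h2 := (hθ.norm_residual_le hK hV hu hcP hP (hmem m hm).1 (hmem m hm).2
      (M.t_pred_lt hm').le).1
    have h3 : ‖(1 / M.len m) • vecToL2 ((toH1 u (M.t m) - θ (M.t m))
        - (toH1 u (M.t (m - 1)) - θ (M.t (m - 1))))‖ ≤ cP * A := by
      rw [norm_smul, Real.norm_of_nonneg (by positivity), one_div, inv_mul_le_iff₀ hlen]
      exact h2
    -- Three parts: the quotient of $\xi$, controlled by stability; the quotient of $u-\theta$, of
    -- size `cP * A`; and the $O(\tau^2)$ consistency error.
    have e : timeDeriv T u (M.mid m) - (1 / M.len m) • vecToL2 (uh (M.t m) - uh (M.t (m - 1)))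
        = (1 / M.len m) • vecToL2 ((θ (M.t m) - uh (M.t m))
            - (θ (M.t (m - 1)) - uh (M.t (m - 1))))
          + ((1 / M.len m) • vecToL2 ((toH1 u (M.t m) - θ (M.t m))
            - (toH1 u (M.t (m - 1)) - θ (M.t (m - 1))))
          + (timeDeriv T u (M.mid m)
            - (1 / M.len m) • vecToL2 (toH1 u (M.t m) - toH1 u (M.t (m - 1))))) := by
      simp only [map_sub]; module
    rw [e]
    refine (norm_add_le _ _).trans (add_le_add_right ((norm_add_le _ _).trans ?_) _)
    refine add_le_add h3 (h1.trans ?_)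
    exact mul_le_mul_of_nonneg_left (pow_le_pow_left₀ hlen.le (M.len_le_size hm') 2)
      (mul_nonneg zero_le_two hK.nonneg)
  · have e : grad (velocityError u uh (M.t n))
        = grad (θ (M.t n) - uh (M.t n)) + grad (toH1 u (M.t n) - θ (M.t n)) := by
      rw [← map_add]; congr 1; rw [velocityError]; abel
    rw [e]
    exact (norm_add_le _ _).trans (add_le_add_right (hθ.bound _ (M.t_mem hn)) _)

/-- Error in `L²` at the mesh points and of the gradient at the midpoints. -/
lemma IsDiscreteSolution.error_weak (hs : IsDiscreteSolution f Vh Qh M u₀h uh ph)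
    (hu : IsRegularStokesSolution Ω T r hr f u₀ u p) (hT : 0 < T) (hV : Vh ≤ velocitySpace Ω)
    (hθ : IsStokesProjection T u p Vh Qh θ A) (hA : 0 ≤ A) (hK : HasRegularityBound T u p K)
    (hcP : 0 ≤ cP) (hP : ∀ v ∈ velocitySpace Ω, ‖vecToL2 v‖ ≤ cP * ‖grad v‖) (hn : n ≤ M.N) :
    ∑ m ∈ Finset.Icc 1 n, M.len m * ‖grad (velocityError u uh (M.mid m))‖ ^ 2
        + ‖(velocityError u uh (M.t n)).toL2‖ ^ 2
      ≤ 2 * (2 * ‖(velocityError u uh 0).toL2‖ ^ 2 + 2 * (cP * A) ^ 2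
          + T * (cP * (cP * A + 2 * K * M.size ^ 2)) ^ 2)
        + 2 * (T * (A + d * K * M.size ^ 2) ^ 2) + 2 * (cP * A) ^ 2 := by
  have hsub : ∀ m ∈ Finset.Icc 1 n, m ∈ Finset.Icc 1 M.N := fun m hm =>
    Finset.Icc_subset_Icc_right hn hm
  have hmem : ∀ m ∈ Finset.Icc 1 n, M.t (m - 1) ∈ Icc 0 T ∧ M.t m ∈ Icc 0 T := fun m hm => by
    have := Finset.mem_Icc.1 (hsub m hm)
    exact ⟨M.t_mem (by omega), M.t_mem this.2⟩
  have hη : ∀ t ∈ Icc 0 T, ‖vecToL2 (toH1 u t - θ t)‖ ≤ cP * A := fun t ht =>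
    (hP _ ((velocitySpace Ω).sub_mem (hu.boundary t ht) (hV (hθ.mem t).1))).trans
      (mul_le_mul_of_nonneg_left (hθ.bound t ht) hcP)
  have hK0 := hK.nonneg
  have hstab := crankNicolson_stability_weak (J := vecToL2) (G := grad)
    (W := discreteDivFreeSubmodule Vh Qh) (ξ := fun m => θ (M.t m) - uh (M.t m))
    (ρ := fun m => vecToL2 (θ (M.t m) - θ (M.t (m - 1)))
        - (M.len m / 2) • (timeDeriv T u (M.t (m - 1)) + timeDeriv T u (M.t m)))
    (τ := M.len) (n := n) (T := T) (K := cP * A + 2 * K * M.size ^ 2) (cP := cP)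
    (fun m hm => Submodule.sub_mem _ (hθ.mem _) (hs.mem_discreteDivFree (hm.trans hn)))
    (fun m hm => M.len_pos (hsub m hm)) (M.sum_len_le hn) (by positivity)
    (fun m hm => TimeMesh.len_mul_residual_le hK.nonneg (hsub m hm)
      (hθ.norm_residual_le hK hV hu hcP hP (hmem m hm).1 (hmem m hm).2
        (M.t_pred_lt (hsub m hm)).le).2)
    (fun w hw => hP w (hV hw.1))
    (fun m hm w hw => hs.error_equation hu hT hV hθ (hsub m hm) hw)
  have h0 : M.t 0 = 0 := M.t_zero
  have hξ0 : ‖vecToL2 (θ (M.t 0) - uh (M.t 0))‖ ^ 2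
      ≤ 2 * ‖(velocityError u uh 0).toL2‖ ^ 2 + 2 * (cP * A) ^ 2 := by
    rw [h0]
    have e : vecToL2 (θ 0 - uh 0)
        = vecToL2 (velocityError u uh 0) - vecToL2 (toH1 u 0 - θ 0) := by
      rw [← map_sub]; congr 1; rw [velocityError]; abel
    have h1 : ‖vecToL2 (θ 0 - uh 0)‖ ≤ ‖vecToL2 (velocityError u uh 0)‖ + cP * A := by
      rw [e]
      exact (norm_sub_le _ _).trans (add_le_add_right (hη 0 ⟨le_rfl, hT.le⟩) _)
    have := (pow_le_pow_left₀ (norm_nonneg _) h1 2).trans add_sq_le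
    rw [← mul_add]
    exact this
  refine sum_sq_add_sq_le_of_perturbation
    (x := fun m => ‖grad ((1 / 2 : ℝ) • ((θ (M.t (m - 1)) - uh (M.t (m - 1)))
      + (θ (M.t m) - uh (M.t m))))‖)
    (y := fun m => ‖grad (velocityError u uh (M.mid m))‖)
    (a := ‖vecToL2 (θ (M.t n) - uh (M.t n))‖)
    (fun m hm => M.len_pos (hsub m hm)) (M.sum_len_le hn) (fun m hm => ⟨norm_nonneg _, ?_⟩)
    ⟨norm_nonneg _, ?_⟩ (hstab.trans (add_le_add_left hξ0 _))
  · have hm' := hsub m hm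
    have hlen := M.len_pos hm'
    have h1 := hK.average _ (hmem m hm).1 _ (hmem m hm).2 (M.t_pred_lt hm').le
    have h2 := (norm_grad_le _).trans (mul_le_mul_of_nonneg_left h1 (Nat.cast_nonneg d))
    have h3 := pow_le_pow_left₀ hlen.le (M.len_le_size hm') 2
    have h4 : (d : ℝ) * (K * M.len m ^ 2) ≤ d * (K * M.size ^ 2) := by gcongr
    have h5 : ‖(1 / 2 : ℝ) • (grad (toH1 u (M.t (m - 1)) - θ (M.t (m - 1)))
        + grad (toH1 u (M.t m) - θ (M.t m)))‖ ≤ A := by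
      rw [norm_smul, Real.norm_of_nonneg (by norm_num)]
      have := norm_add_le (grad (toH1 u (M.t (m - 1)) - θ (M.t (m - 1))))
        (grad (toH1 u (M.t m) - θ (M.t m)))
      linarith [hθ.bound _ (hmem m hm).1, hθ.bound _ (hmem m hm).2]
    -- As `uh` at the midpoint is the nodal average, the error there is the average of $\xi$, the
    -- average of $u-\theta$, and the defect of $u$ from its own average, which is $O(\tau^2)$ in
    -- $H^1$.
    have e : grad (velocityError u uh (M.mid m))
        = grad ((1 / 2 : ℝ) • ((θ (M.t (m - 1)) - uh (M.t (m - 1))) + (θ (M.t m) - uh (M.t m))))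
          + ((1 / 2 : ℝ) • (grad (toH1 u (M.t (m - 1)) - θ (M.t (m - 1)))
            + grad (toH1 u (M.t m) - θ (M.t m)))
          + grad (toH1 u (M.mid m)
            - (1 / 2 : ℝ) • (toH1 u (M.t (m - 1)) + toH1 u (M.t m)))) := by
      rw [velocityError, hs.mid_eq hm']
      simp only [map_sub, map_add, map_smul]; module
    rw [e]
    refine (norm_add_le _ _).trans (add_le_add_right ((norm_add_le _ _).trans ?_) _)
    refine add_le_add h5 (h2.trans ?_)
    rw [mul_assoc]
    exact h4
  · have e : (velocityError u uh (M.t n)).toL2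
        = vecToL2 (θ (M.t n) - uh (M.t n)) + vecToL2 (toH1 u (M.t n) - θ (M.t n)) := by
      change vecToL2 _ = _
      rw [← map_add]; congr 1; rw [velocityError]; abel
    rw [e]
    exact (norm_add_le _ _).trans (add_le_add_right (hη _ (M.t_mem hn)) _)

end ErrorBounds

end StokesCGP

end

/-! ### Assembly of the constant. -/

theorem mainTheorem2 {d : ℕ} (hd : d = 2 ∨ d = 3)
    (Ω : TopologicalSpace.Opens (StokesCGP.Pt d))
    (hΩ : Bornology.IsBounded (Ω : Set (StokesCGP.Pt d)))
    (T : ℝ) (hT : 0 < T) (r : ℕ) (hr : 1 ≤ r)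
    (f : ℝ → StokesCGP.VecL2 Ω) (u₀ : StokesCGP.VecL2 Ω)
    (u : ℝ → StokesCGP.VecSobolev (r + 1) Ω) (p : ℝ → StokesCGP.Sobolev r Ω)
    (hu : StokesCGP.IsRegularStokesSolution Ω T r hr f u₀ u p)
    (β : ℝ) (hβ : 0 < β) (cA : ℝ) :
    ∃ C : ℝ, 0 < C ∧
      ∀ (h : ℝ) (Vh : Submodule ℝ (StokesCGP.VecSobolev 1 Ω)) (Qh : Submodule ℝ (StokesCGP.L2 Ω)),
      StokesCGP.IsFEPair Ω r β cA h Vh Qh →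
      ∀ (M : StokesCGP.TimeMesh T) (u₀h : StokesCGP.VecSobolev 1 Ω)
        (uh : ℝ → StokesCGP.VecSobolev 1 Ω) (ph : ℝ → StokesCGP.L2 Ω),
      StokesCGP.IsDiscreteSolution f Vh Qh M u₀h uh ph →
      ∀ n ∈ Finset.Icc 1 M.N,
        ((∑ m ∈ Finset.Icc 1 n, M.len m *
              ‖deriv (fun s => (StokesCGP.velocityError u uh s).toL2) (M.mid m)‖ ^ 2)
            + StokesCGP.gradNorm (StokesCGP.velocityError u uh (M.t n)) ^ 2
          ≤ C * (StokesCGP.gradNorm (StokesCGP.velocityError u uh 0) ^ 2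
              + M.size ^ 4 + h ^ (2 * r))) ∧
        (‖(StokesCGP.velocityError u uh (M.t n)).toL2‖ ^ 2
            + (∑ m ∈ Finset.Icc 1 n, M.len m *
              StokesCGP.gradNorm (StokesCGP.velocityError u uh (M.mid m)) ^ 2)
          ≤ C * (‖(StokesCGP.velocityError u uh 0).toL2‖ ^ 2
              + M.size ^ 4 + h ^ (2 * r))) := by
  obtain ⟨K, hK⟩ := hu.exists_regularityBound hT
  have hK0 := hK.nonneg
  obtain ⟨R, hR⟩ := hΩ.exists_norm_le
  -- For empty $\Omega$ the bound `R` could be negative.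
  have hR' : ∀ x ∈ (Ω : Set (StokesCGP.Pt d)), ‖x‖ ≤ max R 0 := fun x hx =>
    (hR x hx).trans (le_max_left _ _)
  obtain ⟨cP, hcP⟩ : ∃ cP : ℝ, cP = 2 * max R 0 := ⟨_, rfl⟩
  have hcP0 : 0 ≤ cP := by rw [hcP]; positivity
  have hP : ∀ v ∈ StokesCGP.velocitySpace Ω,
      ‖StokesCGP.vecToL2 v‖ ≤ cP * ‖StokesCGP.grad v‖ := fun v hv => by
    rw [hcP]
    exact StokesCGP.poincare_velocitySpace (by omega) (le_max_right _ _) hR' hv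
  obtain ⟨B, hB⟩ : ∃ B : ℝ, B = (2 * (1 + d * d / β) + d) * |cA| * K := ⟨_, rfl⟩
  have hB0 : 0 ≤ B := by rw [hB]; positivity
  -- With $A=Bh^r$, the strong bound contributes $6+8Tc_P^2$ to the $B^2$ factor and 32 to the
  -- $K^2T$ factor; the weak bound contributes the remaining terms. The 4 comes from squaring two
  -- triangle inequalities on the initial error.
  refine ⟨4 + B ^ 2 * (6 + 8 * T * cP ^ 2 + 6 * cP ^ 2 + 4 * T * cP ^ 4 + 4 * T)
    + K ^ 2 * T * (32 + 16 * cP ^ 2 + 4 * d ^ 2), by positivity, ?_⟩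
  intro h Vh Qh hFE M u₀h uh ph hs n hn
  have hn' := (Finset.mem_Icc.1 hn).2
  obtain ⟨θ, hθ⟩ := hFE.exists_isStokesProjection hβ hΩ hu hT hK
  rw [← hB] at hθ
  have hh := hFE.h_pos
  have hA0 : 0 ≤ B * h ^ r := by positivity
  have h1 := hs.error_strong hu hT hFE.sub_V hθ hK hcP0 hP hn'
  have h2 := hs.error_weak hu hT hFE.sub_V hθ hA0 hK hcP0 hP hn'
  have hpow : (B * h ^ r) ^ 2 = B ^ 2 * h ^ (2 * r) := by rw [mul_pow, ← pow_mul, mul_comm r]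
  obtain ⟨H, hH⟩ : ∃ H : ℝ, H = h ^ (2 * r) := ⟨_, rfl⟩
  have hH0 : 0 ≤ H := by rw [hH]; positivity
  obtain ⟨S, hS⟩ : ∃ S : ℝ, S = M.size := ⟨_, rfl⟩
  have hD : (cP * (B * h ^ r) + 2 * K * S ^ 2) ^ 2
      ≤ 2 * cP ^ 2 * (B ^ 2 * H) + 8 * K ^ 2 * S ^ 4 := by
    refine add_sq_le.trans (le_of_eq ?_)
    rw [mul_pow cP, hpow, hH]; ring
  have hF : (B * h ^ r + d * K * S ^ 2) ^ 2 ≤ 2 * (B ^ 2 * H) + 2 * d ^ 2 * K ^ 2 * S ^ 4 := by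
    refine add_sq_le.trans (le_of_eq ?_)
    rw [hpow, hH]; ring
  simp only [StokesCGP.gradNorm_eq]
  rw [← hS, hpow, ← hH] at h1
  rw [← hS, mul_pow cP (B * h ^ r), hpow, ← hH, mul_pow cP] at h2
  rw [← hS, ← hH]
  have hTD := mul_le_mul_of_nonneg_left hD hT.le
  have hTD' := mul_le_mul_of_nonneg_left hD (by positivity : 0 ≤ T * cP ^ 2)
  have hTF := mul_le_mul_of_nonneg_left hF hT.le
  have hS4 : 0 ≤ S ^ 4 := by positivity
  constructor
  · obtain ⟨g, hg⟩ : ∃ g : ℝ, g = ‖StokesCGP.grad (StokesCGP.velocityError u uh 0)‖ ^ 2 :=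
      ⟨_, rfl⟩
    have hg0 : 0 ≤ g := by rw [hg]; positivity
    rw [← hg] at h1 ⊢
    -- `p1`, `p2`, `p3` are the surpluses of the common constant over what this bound needs for `g`,
    -- `S ^ 4` and `H`.
    have p1 : 0 ≤ (B ^ 2 * (6 + 8 * T * cP ^ 2 + 6 * cP ^ 2 + 4 * T * cP ^ 4 + 4 * T)
      + K ^ 2 * T * (32 + 16 * cP ^ 2 + 4 * d ^ 2)) * g := by positivity
    have p2 : 0 ≤ (4 + B ^ 2 * (6 + 8 * T * cP ^ 2 + 6 * cP ^ 2 + 4 * T * cP ^ 4 + 4 * T)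
      + K ^ 2 * T * (16 * cP ^ 2 + 4 * d ^ 2)) * S ^ 4 := by positivity
    have p3 : 0 ≤ (4 + B ^ 2 * (6 * cP ^ 2 + 4 * T * cP ^ 4 + 4 * T)
      + K ^ 2 * T * (32 + 16 * cP ^ 2 + 4 * d ^ 2)) * H := by positivity
    linarith
  · obtain ⟨g, hg⟩ : ∃ g : ℝ, g = ‖(StokesCGP.velocityError u uh 0).toL2‖ ^ 2 := ⟨_, rfl⟩
    have hg0 : 0 ≤ g := by rw [hg]; positivity
    rw [← hg] at h2 ⊢
    have p1 : 0 ≤ (B ^ 2 * (6 + 8 * T * cP ^ 2 + 6 * cP ^ 2 + 4 * T * cP ^ 4 + 4 * T)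
      + K ^ 2 * T * (32 + 16 * cP ^ 2 + 4 * d ^ 2)) * g := by positivity
    have p2 : 0 ≤ (4 + B ^ 2 * (6 + 8 * T * cP ^ 2 + 6 * cP ^ 2 + 4 * T * cP ^ 4 + 4 * T)
      + K ^ 2 * T * 32) * S ^ 4 := by positivity
    have p3 : 0 ≤ (4 + B ^ 2 * (6 + 8 * T * cP ^ 2)
      + K ^ 2 * T * (32 + 16 * cP ^ 2 + 4 * d ^ 2)) * H := by positivity
    linarith
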